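/- Let $1<q<p<\infty$, let $\Omega=(a,b)\subset\mathbb{R}$ be a bounded open interval, and let $\alpha,\beta\in\mathbb{R}$. For $r>1$ let $S(r)=\{u\in W_0^{1,r}(\Omega):\ \|u\|_{L^r(\Omega)}=1\}$, and let $$\lambda_2(r)=\inf_{h}\ \max_{z\in S^{1}}\ \int_\Omega |h(z)'|^r\,dx ,$$ the infimum being taken over all odd continuous maps $h:S^1\to S(r)$ from the unit circle $S^1\subset\mathbb{R}^2$ (this is the second eigenvalue of the Dirichlet $r$-Laplacian on $\Omega$). A (weak) solution of $$(GEV;\alpha,\beta)\qquad -(|u'|^{p-2}u')'-(|u'|^{q-2}u')'=\alpha|u|^{p-2}u+\beta|u|^{q-2}u\ \text{ in }\Omega,\qquad u=0\ \text{ on }\partial\Omega,$$ is a function $u\in W_0^{1,p}(\Omega)$ such that $$\int_\Omega |u'|^{p-2}u'\varphi'\,dx+\int_\Omega |u'|^{q-2}u'\varphi'\,dx=\alpha\int_\Omega|u|^{p-2}u\,\varphi\,dx+\beta\int_\Omega|u|^{q-2}u\,\varphi\,dx\quad\text{for all }\varphi\in W_0^{1,p}(\Omega);$$ it is called nodal if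 neither $u^+=\max\{u,0\}$ nor $u^-=\max\{-u,0\}$ vanishes almost everywhere in $\Omega$. If $\alpha\le\lambda_2(p)$ and $\beta\le\lambda_2(q)$, then $(GEV;\alpha,\beta)$ has no nodal solutions. -/

import Mathlib

open MeasureTheory Set
open scoped ENNReal ContDiff

noncomputable section

namespace PQLaplace

instance fact_one_le_ofReal (r : ℝ) [h : Fact (1 < r)] : Fact (1 ≤ ENNReal.ofReal r) :=
  ⟨by simpa using ENNReal.ofReal_le_ofReal h.out.le⟩

/-- The Lebesgue space `L^r(a, b)`. -/
abbrev LrI (r a b : ℝ) : Type :=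
  Lp ℝ (ENNReal.ofReal r) (volume.restrict (Ioo a b))

/-- `φ ∈ C_c^∞(a, b)`: smooth with compact support contained in the open interval `(a, b)`. -/
structure IsTestFun (a b : ℝ) (φ : ℝ → ℝ) : Prop where
  smooth : ContDiff ℝ ∞ φ
  hasCompactSupport : HasCompactSupport φ
  tsupport_subset : tsupport φ ⊆ Ioo a b

/-- The copy `{(φ, φ') : φ ∈ C_c^∞(a, b)}` of the test functions in `L^r(a, b) × L^r(a, b)`. -/
def testGraph (r a b : ℝ) [Fact (1 < r)] : Submodule ℝ (LrI r a b × LrI r a b) where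
  carrier := {w | ∃ φ : ℝ → ℝ, IsTestFun a b φ ∧
    (w.1 : ℝ → ℝ) =ᵐ[volume.restrict (Ioo a b)] φ ∧
    (w.2 : ℝ → ℝ) =ᵐ[volume.restrict (Ioo a b)] deriv φ}
  zero_mem' := by
    refine ⟨0, ⟨contDiff_const, HasCompactSupport.zero, ?_⟩, ?_, ?_⟩
    · simp [tsupport]
    · exact Lp.coeFn_zero _ _ _
    · have h : deriv (0 : ℝ → ℝ) = 0 := by ext x; simp
      rw [h]; exact Lp.coeFn_zero _ _ _
  add_mem' := by
    rintro w₁ w₂ ⟨φ, hφ, h1, h1'⟩ ⟨ψ, hψ, h2, h2'⟩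
    refine ⟨φ + ψ, ⟨hφ.smooth.add hψ.smooth, hφ.hasCompactSupport.add hψ.hasCompactSupport,
      (tsupport_add φ ψ).trans (union_subset hφ.tsupport_subset hψ.tsupport_subset)⟩, ?_, ?_⟩
    · exact (Lp.coeFn_add w₁.1 w₂.1).trans (h1.add h2)
    · have h : deriv (φ + ψ) = deriv φ + deriv ψ := by
        ext x
        exact deriv_add (hφ.smooth.differentiable (by simp) x)
          (hψ.smooth.differentiable (by simp) x)
      rw [h]
      exact (Lp.coeFn_add w₁.2 w₂.2).trans (h1'.add h2')
  smul_mem' := by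
    rintro c w ⟨φ, hφ, h1, h1'⟩
    refine ⟨c • φ, ⟨hφ.smooth.const_smul c, hφ.hasCompactSupport.smul_left (f := fun _ => c),
      (closure_mono (Function.support_const_smul_subset c φ)).trans hφ.tsupport_subset⟩, ?_, ?_⟩
    · exact (Lp.coeFn_smul c w.1).trans (h1.const_smul c)
    · have h : deriv (c • φ) = c • deriv φ := by
        ext x
        exact deriv_const_smul c (hφ.smooth.differentiable (by simp) x)
      rw [h]
      exact (Lp.coeFn_smul c w.2).trans (h1'.const_smul c)

/-- The Sobolev space `W_0^{1,r}(a, b)`: the closure of `C_c^∞(a, b)` in `W^{1,r}(a, b)`. The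
latter is regarded as a closed subspace of `L^r × L^r` through `u ↦ (u, u')`, so an element is the
pair of a function and its weak derivative (which the function determines). The norm inherited
from `L^r × L^r` is equivalent to `‖u'‖_r`, by the Poincaré inequality. -/
abbrev W0 (r a b : ℝ) [Fact (1 < r)] : Submodule ℝ (LrI r a b × LrI r a b) :=
  (testGraph r a b).topologicalClosure

variable {r a b : ℝ} [Fact (1 < r)]

/-- The function underlying an element of `W_0^{1,r}(a, b)`. -/
def W0.val (u : W0 r a b) : LrI r a b := (u : LrI r a b × LrI r a b).1

/-- The weak derivative of an element of `W_0^{1,r}(a, b)`. -/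
def W0.grad (u : W0 r a b) : LrI r a b := (u : LrI r a b × LrI r a b).2

/-- `S(r) = {u ∈ W_0^{1,r}(a, b) : ‖u‖_r = 1}`. -/
def unitLr (r a b : ℝ) [Fact (1 < r)] : Set (W0 r a b) :=
  {u | ‖W0.val u‖ = 1}

/-- The minimax eigenvalue `λ_k(r)` of the Dirichlet `r`-Laplacian on `(a, b)`: the infimum, over
the odd continuous maps `h : S^{k-1} → S(r)`, of `max_{z ∈ S^{k-1}} ‖h(z)'‖_r^r`. -/
def eigenvalue (k : ℕ) (r a b : ℝ) [Fact (1 < r)] : ℝ :=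
  sInf {M : ℝ | ∃ h : C(Metric.sphere (0 : EuclideanSpace ℝ (Fin k)) 1, unitLr r a b),
    (∀ z, (h (-z) : W0 r a b) = -(h z : W0 r a b)) ∧
    IsGreatest (range fun z => ‖W0.grad (h z : W0 r a b)‖ ^ r) M}

/-- `u ∈ W_0^{1,p}(a, b)` is a weak solution of
`-Δ_p u - Δ_q u = α |u|^{p-2} u + β |u|^{q-2} u` in `(a, b)`, `u(a) = u(b) = 0`. -/
def IsWeakSolution (p q a b α β : ℝ) [Fact (1 < p)] (u : W0 p a b) : Prop :=
  ∀ φ : W0 p a b,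
    (∫ x in Ioo a b, |W0.grad u x| ^ (p - 2) * W0.grad u x * W0.grad φ x)
      + (∫ x in Ioo a b, |W0.grad u x| ^ (q - 2) * W0.grad u x * W0.grad φ x)
    = α * (∫ x in Ioo a b, |W0.val u x| ^ (p - 2) * W0.val u x * W0.val φ x)
      + β * (∫ x in Ioo a b, |W0.val u x| ^ (q - 2) * W0.val u x * W0.val φ x)

/-- A nodal (sign-changing) solution: a weak solution `u` such that neither `u⁺ = max {u, 0}` nor
`u⁻ = max {-u, 0}` vanishes almost everywhere in `(a, b)`. -/
def IsNodalSolution (p q a b α β : ℝ) [Fact (1 < p)] (u : W0 p a b) : Prop :=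
  IsWeakSolution p q a b α β u ∧
    (¬ ∀ᵐ x ∂(volume.restrict (Ioo a b)), max (W0.val u x) 0 = 0) ∧
    (¬ ∀ᵐ x ∂(volume.restrict (Ioo a b)), max (-(W0.val u x)) 0 = 0)

end PQLaplace

end

noncomputable section

namespace PQLaplace

/-! ### Functions of `W_0^{1,r}` as primitives of mean-zero `L^r` functions -/

section

variable {r a b : ℝ}

/-! A nodal solution, taken in its continuous representative, has an interior zero with nonzero
values on both sides of it. The zero cuts `(a, b)` into two pieces, and one of them, `(c, d)`, has
length at most `(b - a) / 2`. On that piece `u` vanishes at both ends without vanishing identically.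

If `d - c ≤ (b - a) / 2`, two disjoint translates of any function of `W_0^{1,r}(c, d)` fit into `(a,
b)`. Their normalized combinations form an odd circle in `S(r)` with constant energy, so `λ₂(r)` is
an admissible Poincaré constant on `(c, d)` (`eigenvalue_two_mul_integral_le`). Testing the equation
with `u` cut off to `(c, d)` shows that the Poincaré inequalities with constants `α` (exponent `p`)
and `β` (exponent `q`) become an equality when added. Hence each is an equality, and `u` is extremal
for both exponents.

This is impossible. Stationarity under changes of the independent variable gives an extremal the
first integral `(r - 1)|u'|^r + λ|u|^r = K` (`poincare_extremal_first_integral`). Eliminating `|u'|`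
from the two first integrals gives `(A - A' s^p)^q = (B - B' s^q)^p` for every value `s` of `|u|` in
an interval `[0, M]`. Near `s = 0` the left side departs from its value at `0` by order `s^p`, the
right side by the larger order `s^q` (`first_integrals_incompatible`).

Since `W_0^{1,r}` is defined as a closure of test functions, it is first identified with the
primitives of mean-zero functions of `L^r`. All later constructions act on the derivative alone. -/

lemma LrI.coeFn_add_ae (f g : LrI r a b) :
    ((f + g : LrI r a b) : ℝ → ℝ) =ᵐ[volume.restrict (Ioo a b)] fun x => f x + g x :=
  Lp.coeFn_add f g

lemma LrI.coeFn_smul_ae (c : ℝ) (f : LrI r a b) :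
    ((c • f : LrI r a b) : ℝ → ℝ) =ᵐ[volume.restrict (Ioo a b)] fun x => c * f x :=
  Lp.coeFn_smul c f

lemma intervalIntegrable_of_integrable_Ioo {f : ℝ → ℝ}
    (hf : Integrable f (volume.restrict (Ioo a b)))
    {x y : ℝ} (hx : x ∈ Icc a b) (hy : y ∈ Icc a b) : IntervalIntegrable f volume x y := by
  have h : IntegrableOn f (Icc a b) volume := by
    rw [integrableOn_Icc_iff_integrableOn_Ioo]; exact hf
  exact (h.mono_set (uIcc_subset_Icc hx hy)).intervalIntegrable

lemma intervalIntegral_congr_Ioo {f g : ℝ → ℝ} (h : f =ᵐ[volume.restrict (Ioo a b)] g)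
    {x y : ℝ} (hx : x ∈ Icc a b) (hy : y ∈ Icc a b) :
    ∫ t in x..y, f t = ∫ t in x..y, g t := by
  apply intervalIntegral.integral_congr_ae_restrict
  have h' : f =ᵐ[volume.restrict (Icc a b)] g := by
    rwa [restrict_Ioo_eq_restrict_Icc] at h
  exact ae_restrict_of_ae_restrict_of_subset
    (uIoc_subset_uIcc.trans (uIcc_subset_Icc hx hy)) h'

lemma LrI.intervalIntegral_smul (c : ℝ) (f : LrI r a b) {x y : ℝ}
    (hx : x ∈ Icc a b) (hy : y ∈ Icc a b) :
    ∫ t in x..y, (c • f : LrI r a b) t = c * ∫ t in x..y, f t := by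
  rw [intervalIntegral_congr_Ioo (LrI.coeFn_smul_ae c f) hx hy,
    intervalIntegral.integral_const_mul]

variable [Fact (1 < r)]

lemma LrI.integrable (f : LrI r a b) : Integrable f (volume.restrict (Ioo a b)) :=
  (Lp.memLp f).integrable (Fact.out : (1 : ℝ≥0∞) ≤ ENNReal.ofReal r)

/-- Hölder's inequality on a bounded interval, with `C` a power of its length. The bound makes
integration and the primitive continuous on `L^r`, so that both commute with closures. -/
lemma LrI.exists_abs_intervalIntegral_le (hab : a ≤ b) : ∃ C : ℝ, 0 ≤ C ∧
    ∀ (f : LrI r a b), ∀ x ∈ Icc a b, |∫ t in a..x, f t| ≤ C * ‖f‖ := by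
  refine ⟨((volume.restrict (Ioo a b)) univ ^
    (1 / (1 : ℝ≥0∞).toReal - 1 / (ENNReal.ofReal r).toReal)).toReal, ENNReal.toReal_nonneg,
    fun f x hx => ?_⟩
  have h1 : |∫ t in a..x, f t| ≤ ∫ t in a..x, |f t| :=
    intervalIntegral.norm_integral_le_integral_norm (f := f) hx.1
  have h2 : ∫ t in a..x, |f t| ≤ ∫ t in a..b, |f t| := by
    apply intervalIntegral.integral_mono_interval le_rfl hx.1 hx.2
    · exact Filter.Eventually.of_forall fun t => abs_nonneg _
    · exact (intervalIntegrable_of_integrable_Ioo f.integrable (left_mem_Icc.2 hab)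
        (right_mem_Icc.2 hab)).abs
  have h3 : ∫ t in a..b, |f t| = (eLpNorm f 1 (volume.restrict (Ioo a b))).toReal := by
    rw [intervalIntegral.integral_of_le hab, integral_Ioc_eq_integral_Ioo,
      eLpNorm_one_eq_lintegral_enorm,
      ← integral_norm_eq_lintegral_enorm f.integrable.aestronglyMeasurable]
    rfl
  have h4 := eLpNorm_le_eLpNorm_mul_rpow_measure_univ (μ := volume.restrict (Ioo a b))
    (Fact.out : (1 : ℝ≥0∞) ≤ ENNReal.ofReal r) f.integrable.aestronglyMeasurable
  have h5 : (0 : ℝ) ≤ 1 / (1 : ℝ≥0∞).toReal - 1 / (ENNReal.ofReal r).toReal := by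
    have hr : 1 < r := Fact.out
    rw [ENNReal.toReal_ofReal (by linarith)]
    simp only [ENNReal.toReal_one, sub_nonneg]
    rw [div_le_div_iff₀] <;> linarith
  have h6 := ENNReal.toReal_mono (ENNReal.mul_ne_top (Lp.memLp f).eLpNorm_ne_top
    (ENNReal.rpow_ne_top_of_nonneg h5 (measure_ne_top _ _))) h4
  rw [ENNReal.toReal_mul] at h6
  rw [Lp.norm_def, mul_comm]
  linarith

lemma LrI.intervalIntegral_add (f g : LrI r a b) {x y : ℝ} (hx : x ∈ Icc a b) (hy : y ∈ Icc a b) :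
    ∫ t in x..y, (f + g : LrI r a b) t = (∫ t in x..y, f t) + ∫ t in x..y, g t := by
  rw [intervalIntegral_congr_Ioo (LrI.coeFn_add_ae f g) hx hy,
    intervalIntegral.integral_add (intervalIntegrable_of_integrable_Ioo f.integrable hx hy)
      (intervalIntegrable_of_integrable_Ioo g.integrable hx hy)]

/-- Integration over `(a, b)` is a continuous linear functional on `L^r(a, b)`. -/
lemma exists_integralCLM (hab : a ≤ b) :
    ∃ I : LrI r a b →L[ℝ] ℝ, ∀ f, I f = ∫ t in a..b, f t := by
  have hl := left_mem_Icc.2 hab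
  have hr := right_mem_Icc.2 hab
  obtain ⟨C, -, hC⟩ := LrI.exists_abs_intervalIntegral_le (r := r) hab
  exact ⟨LinearMap.mkContinuous
    { toFun := fun f => ∫ t in a..b, f t
      map_add' := fun f g => LrI.intervalIntegral_add f g hl hr
      map_smul' := fun c f => LrI.intervalIntegral_smul c f hl hr } C fun f => hC f b hr,
    fun _ => rfl⟩

lemma continuousOn_primitive_Ioo (hab : a ≤ b) {f : ℝ → ℝ}
    (hf : Integrable f (volume.restrict (Ioo a b))) :
    ContinuousOn (fun x => ∫ t in a..x, f t) (Icc a b) := by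
  have := intervalIntegral.continuousOn_primitive_interval'
    (intervalIntegrable_of_integrable_Ioo hf (left_mem_Icc.2 hab) (right_mem_Icc.2 hab)) left_mem_uIcc
  rwa [uIcc_of_le hab] at this

lemma memLp_primitive (hab : a ≤ b) {f : ℝ → ℝ}
    (hf : Integrable f (volume.restrict (Ioo a b))) (s : ℝ≥0∞) :
    MemLp (fun x => ∫ t in a..x, f t) s (volume.restrict (Ioo a b)) := by
  have hc := continuousOn_primitive_Ioo hab hf
  obtain ⟨C, hC⟩ := isCompact_Icc.exists_bound_of_continuousOn hc
  exact MemLp.of_bound ((hc.mono Ioo_subset_Icc_self).aestronglyMeasurable measurableSet_Ioo) C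
    ((ae_restrict_iff' measurableSet_Ioo).2
      (Filter.Eventually.of_forall fun x hx => hC x (Ioo_subset_Icc_self hx)))

/-- The primitive vanishing at `a`, as a continuous linear operator on `L^r(a, b)`. -/
lemma exists_primitiveCLM (hab : a ≤ b) :
    ∃ P : LrI r a b →L[ℝ] LrI r a b, ∀ f,
      (P f : ℝ → ℝ) =ᵐ[volume.restrict (Ioo a b)] fun x => ∫ t in a..x, f t := by
  have hm : ∀ᵐ x ∂(volume.restrict (Ioo a b)), x ∈ Icc a b :=
    (ae_restrict_iff' measurableSet_Ioo).2
      (Filter.Eventually.of_forall fun x hx => Ioo_subset_Icc_self hx)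
  let T : LrI r a b →ₗ[ℝ] LrI r a b :=
    { toFun := fun f => (memLp_primitive hab f.integrable (ENNReal.ofReal r)).toLp
      map_add' := fun f g => by
        rw [← MemLp.toLp_add]
        refine (MemLp.toLp_eq_toLp_iff _ _).2 ?_
        filter_upwards [hm] with x hx
        exact LrI.intervalIntegral_add f g (left_mem_Icc.2 hab) hx
      map_smul' := fun c f => by
        rw [RingHom.id_apply, ← MemLp.toLp_const_smul]
        refine (MemLp.toLp_eq_toLp_iff _ _).2 ?_
        filter_upwards [hm] with x hx
        exact LrI.intervalIntegral_smul c f (left_mem_Icc.2 hab) hx }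
  have hT : ∀ f, (T f : ℝ → ℝ) =ᵐ[volume.restrict (Ioo a b)] fun x => ∫ t in a..x, f t :=
    fun f => MemLp.coeFn_toLp (memLp_primitive hab f.integrable _)
  obtain ⟨C, hC0, hC⟩ := LrI.exists_abs_intervalIntegral_le (r := r) hab
  refine ⟨T.mkContinuous (measureUnivNNReal (volume.restrict (Ioo a b)) ^
    (ENNReal.ofReal r).toReal⁻¹ * C) fun f => ?_, hT⟩
  rw [mul_assoc]
  refine Lp.norm_le_of_ae_bound (by positivity) ?_
  filter_upwards [hm, hT f] with x hx hx'
  rw [hx']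
  exact hC f x hx

/-- Test functions are dense in `L^r(a, b)`. -/
lemma exists_isTestFun_eLpNorm_sub_le (hab : a < b) {v : ℝ → ℝ}
    (hv : MemLp v (ENNReal.ofReal r) (volume.restrict (Ioo a b))) {ε : ℝ} (hε : 0 < ε) :
    ∃ g, IsTestFun a b g ∧
      eLpNorm (v - g) (ENNReal.ofReal r) (volume.restrict (Ioo a b)) ≤ ENNReal.ofReal ε := by
  have h1 : (1 : ℝ≥0∞) ≤ ENNReal.ofReal r := Fact.out
  -- Absolute continuity of the norm: discarding strips of width `η` at the two ends, of total
  -- measure at most `δ`, costs at most `ε / 2`.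
  obtain ⟨δ, hδ, hs⟩ := hv.eLpNorm_indicator_le h1 ENNReal.ofReal_ne_top (half_pos hε)
  obtain ⟨η, hη, hη1, hη2⟩ : ∃ η : ℝ, 0 < η ∧ 2 * η < b - a ∧ 2 * η ≤ δ :=
    ⟨min (b - a) δ / 3, by have := sub_pos.2 hab; positivity,
      by linarith [min_le_left (b - a) δ, sub_pos.2 hab], by linarith [min_le_right (b - a) δ]⟩
  set s : Set ℝ := Icc (a + η) (b - η) with hsdef
  have hsm : MeasurableSet s := measurableSet_Icc
  have hμ : volume.restrict (Ioo a b) sᶜ ≤ ENNReal.ofReal δ := by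
    rw [Measure.restrict_apply hsm.compl]
    have hsub : sᶜ ∩ Ioo a b ⊆ Ioo a (a + η) ∪ Ioo (b - η) b := by
      rintro x ⟨hx, hx1, hx2⟩
      simp only [hsdef, mem_compl_iff, mem_Icc, not_and_or, not_le] at hx
      rcases hx with hx | hx
      · exact Or.inl ⟨hx1, hx⟩
      · exact Or.inr ⟨hx, hx2⟩
    refine (measure_mono hsub).trans ((measure_union_le _ _).trans ?_)
    rw [Real.volume_Ioo, Real.volume_Ioo, ← ENNReal.ofReal_add (by linarith) (by linarith)]
    exact ENNReal.ofReal_le_ofReal (by linarith)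
  have hA := hs sᶜ hsm.compl hμ
  obtain ⟨g, hgc, hgs, hg⟩ := (hv.indicator hsm).exist_eLpNorm_sub_le ENNReal.ofReal_ne_top h1
    (half_pos hε)
  -- The cutoff is `1` on `s` and supported inside `(a, b)`. Multiplying the approximant by it
  -- localizes the support, and `0 ≤ χ ≤ 1` keeps the error from growing.
  let χ : ContDiffBump ((a + b) / 2 : ℝ) :=
    ⟨(b - a) / 2 - η, (b - a) / 2 - η / 2, by linarith, by linarith⟩
  have hχ1 : ∀ x ∈ s, χ x = 1 := fun x hx => χ.one_of_mem_closedBall (by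
    rw [Metric.mem_closedBall, Real.dist_eq, abs_le]
    change -((b - a) / 2 - η) ≤ _ ∧ _ ≤ (b - a) / 2 - η
    constructor <;> linarith [hx.1, hx.2])
  have hsmooth : ContDiff ℝ ∞ fun x => χ x * g x := χ.contDiff.mul hgs
  have hsupp : tsupport (fun x => χ x * g x) ⊆ Ioo a b := by
    refine (tsupport_mul_subset_left (f := χ) (g := g)).trans ?_
    rw [χ.tsupport_eq]
    intro x hx
    rw [Metric.mem_closedBall, Real.dist_eq, abs_le] at hx
    change -((b - a) / 2 - η / 2) ≤ _ ∧ _ ≤ (b - a) / 2 - η / 2 at hx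
    constructor <;> linarith [hx.1, hx.2]
  refine ⟨fun x => χ x * g x, ⟨hsmooth, hgc.mul_left, hsupp⟩, ?_⟩
  have hsplit : v - (fun x => χ x * g x) =
      sᶜ.indicator v + fun x => χ x * (s.indicator v - g) x := by
    ext x
    by_cases hx : x ∈ s
    · simp [hx, hχ1 x hx]
    · simp [hx]; ring
  have hB : eLpNorm (fun x => χ x * (s.indicator v - g) x) (ENNReal.ofReal r)
      (volume.restrict (Ioo a b)) ≤ ENNReal.ofReal (ε / 2) := by
    refine le_trans (eLpNorm_mono fun x => ?_) hg
    rw [norm_mul, Real.norm_of_nonneg χ.nonneg]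
    exact mul_le_of_le_one_left (norm_nonneg _) χ.le_one
  rw [hsplit]
  refine (eLpNorm_add_le (hv.indicator hsm.compl).aestronglyMeasurable ?_ h1).trans ?_
  · exact χ.continuous.aestronglyMeasurable.mul
      ((hv.indicator hsm).aestronglyMeasurable.sub hgs.continuous.aestronglyMeasurable)
  · calc _ ≤ ENNReal.ofReal (ε / 2) + ENNReal.ofReal (ε / 2) := add_le_add hA hB
      _ = ENNReal.ofReal ε := by
        rw [← ENNReal.ofReal_add (by linarith) (by linarith), add_halves]

lemma IsTestFun.eq_zero_of_notMem {φ : ℝ → ℝ} (h : IsTestFun a b φ) {x : ℝ} (hx : x ∉ Ioo a b) :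
    φ x = 0 :=
  image_eq_zero_of_notMem_tsupport fun hx' => hx (h.tsupport_subset hx')

lemma IsTestFun.deriv {φ : ℝ → ℝ} (h : IsTestFun a b φ) : IsTestFun a b (deriv φ) :=
  ⟨(contDiff_infty_iff_deriv.1 h.smooth).2, h.hasCompactSupport.deriv,
    (tsupport_deriv_subset).trans h.tsupport_subset⟩

lemma IsTestFun.integral_deriv {φ : ℝ → ℝ} (h : IsTestFun a b φ) (x : ℝ) :
    ∫ t in a..x, _root_.deriv φ t = φ x := by
  rw [intervalIntegral.integral_deriv_eq_sub' φ rfl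
    (fun y _ => (contDiff_infty_iff_deriv.1 h.smooth).1 y) h.deriv.smooth.continuous.continuousOn,
    h.eq_zero_of_notMem (x := a) (by simp), sub_zero]

lemma IsTestFun.memLp {φ : ℝ → ℝ} (h : IsTestFun a b φ) (s : ℝ≥0∞) :
    MemLp φ s (volume.restrict (Ioo a b)) :=
  h.smooth.continuous.memLp_of_hasCompactSupport h.hasCompactSupport

/-- The support of `g` lies in some `[c, d]` inside `(a, b)`. The primitive vanishes before `c`, and
the zero mean makes it vanish again after `d`. -/
lemma IsTestFun.primitive (hab : a < b) {g : ℝ → ℝ} (h : IsTestFun a b g)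
    (h0 : ∫ t in a..b, g t = 0) : IsTestFun a b (fun x => ∫ t in a..x, g t) ∧
      _root_.deriv (fun x => ∫ t in a..x, g t) = g := by
  have hd : ∀ x, HasDerivAt (fun x => ∫ t in a..x, g t) (g x) x := fun x =>
    h.smooth.continuous.integral_hasStrictDerivAt a x |>.hasDerivAt
  have hd' : _root_.deriv (fun x => ∫ t in a..x, g t) = g := funext fun x => (hd x).deriv
  have hint : ∀ x y, IntervalIntegrable g volume x y := fun x y =>
    h.smooth.continuous.intervalIntegrable x y
  obtain ⟨c, d, hac, hcd, hdb, hsub⟩ : ∃ c d, a < c ∧ c ≤ d ∧ d < b ∧ tsupport g ⊆ Icc c d := by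
    rcases (tsupport g).eq_empty_or_nonempty with he | hne
    · exact ⟨(a + b) / 2, (a + b) / 2, by linarith, le_rfl, by linarith, by simp [he]⟩
    · have hK : IsCompact (tsupport g) := h.hasCompactSupport
      have hc := hK.sInf_mem hne
      have hd := hK.sSup_mem hne
      exact ⟨sInf (tsupport g), sSup (tsupport g), (h.tsupport_subset hc).1,
        csInf_le hK.bddBelow hd, (h.tsupport_subset hd).2,
        fun x hx => ⟨csInf_le hK.bddBelow hx, le_csSup hK.bddAbove hx⟩⟩
  have hz : ∀ x, x ∉ Icc c d → g x = 0 := fun x hx =>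
    image_eq_zero_of_notMem_tsupport fun hx' => hx (hsub hx')
  have hts : tsupport (fun x => ∫ t in a..x, g t) ⊆ Icc c d := by
    refine closure_minimal (fun x hx => ?_) isClosed_Icc
    by_contra hx'
    refine hx ?_
    rw [mem_Icc, not_and_or, not_le, not_le] at hx'
    rcases hx' with hx' | hx'
    · refine (intervalIntegral.integral_congr (g := fun _ => 0) fun t ht => ?_).trans (by simp)
      refine hz t fun ht' => ?_
      have : t ≤ max a x := ht.2
      have := max_lt hac hx'
      linarith [ht'.1]
    · have : ∫ t in x..b, g t = 0 := by
        refine (intervalIntegral.integral_congr (g := fun _ => 0) fun t ht => ?_).trans (by simp)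
        refine hz t fun ht' => ?_
        have : min x b ≤ t := ht.1
        have := lt_min hx' hdb
        linarith [ht'.2]
      change ∫ t in a..x, g t = 0
      rw [← h0, ← intervalIntegral.integral_add_adjacent_intervals (hint a x) (hint x b), this,
        add_zero]
  refine ⟨⟨?_, ?_, hts.trans fun x hx => ⟨hac.trans_le hx.1, hx.2.trans_lt hdb⟩⟩, hd'⟩
  · exact contDiff_infty_iff_deriv.2 ⟨fun x => (hd x).differentiableAt, by rw [hd']; exact h.smooth⟩
  · exact isCompact_Icc.of_isClosed_subset (isClosed_tsupport _) hts

/-- An element of `W_0^{1,r}(a, b)` is the primitive of its weak derivative, which has mean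
zero. -/
theorem W0.integral_grad_and_val_ae_eq (hab : a < b) (u : W0 r a b) :
    (∫ t in a..b, W0.grad u t = 0) ∧
      (W0.val u : ℝ → ℝ) =ᵐ[volume.restrict (Ioo a b)] fun x => ∫ t in a..x, W0.grad u t := by
  obtain ⟨I, hI⟩ := exists_integralCLM (r := r) hab.le
  obtain ⟨P, hP⟩ := exists_primitiveCLM (r := r) hab.le
  have hm : ∀ᵐ x ∂(volume.restrict (Ioo a b)), x ∈ Icc a b :=
    (ae_restrict_iff' measurableSet_Ioo).2
      (Filter.Eventually.of_forall fun x hx => Ioo_subset_Icc_self hx)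
  -- Both relations are closed conditions on the pair and hold for test functions, hence they hold
  -- on the closure.
  have hclosed : IsClosed {w : LrI r a b × LrI r a b | I w.2 = 0 ∧ w.1 = P w.2} :=
    (isClosed_eq (by fun_prop) (by fun_prop)).inter (isClosed_eq (by fun_prop) (by fun_prop))
  have hsub : (testGraph r a b : Set (LrI r a b × LrI r a b)) ⊆
      {w | I w.2 = 0 ∧ w.1 = P w.2} := by
    rintro w ⟨φ, hφ, h1, h2⟩
    constructor
    · rw [hI, intervalIntegral_congr_Ioo h2 (left_mem_Icc.2 hab.le) (right_mem_Icc.2 hab.le),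
        hφ.integral_deriv, hφ.eq_zero_of_notMem (by simp)]
    · refine Lp.ext ?_
      filter_upwards [h1, hP w.2, hm] with x hx1 hx2 hx
      rw [hx1, hx2, intervalIntegral_congr_Ioo h2 (left_mem_Icc.2 hab.le) hx, hφ.integral_deriv]
  have hu := closure_minimal hsub hclosed u.2
  refine ⟨(hI _).symm.trans hu.1, ?_⟩
  have h : W0.val u = P (W0.grad u) := hu.2
  rw [h]
  exact hP _

/-- The primitive of a mean-zero function of `L^r(a, b)` belongs to `W_0^{1,r}(a, b)`. -/
theorem W0.exists_of_integral_eq_zero (hab : a < b) {v : ℝ → ℝ}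
    (hv : MemLp v (ENNReal.ofReal r) (volume.restrict (Ioo a b))) (h0 : ∫ t in a..b, v t = 0) :
    ∃ u : W0 r a b, (W0.grad u : ℝ → ℝ) =ᵐ[volume.restrict (Ioo a b)] v ∧
      (W0.val u : ℝ → ℝ) =ᵐ[volume.restrict (Ioo a b)] fun x => ∫ t in a..x, v t := by
  obtain ⟨I, hI⟩ := exists_integralCLM (r := r) hab.le
  obtain ⟨P, hP⟩ := exists_primitiveCLM (r := r) hab.le
  have hm : ∀ᵐ x ∂(volume.restrict (Ioo a b)), x ∈ Icc a b :=
    (ae_restrict_iff' measurableSet_Ioo).2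
      (Filter.Eventually.of_forall fun x hx => Ioo_subset_Icc_self hx)
  have hl := left_mem_Icc.2 hab.le
  have hr := right_mem_Icc.2 hab.le
  obtain ⟨ρ, hρ, hρ1⟩ : ∃ ρ, IsTestFun a b ρ ∧ ∫ t in a..b, ρ t = 1 := by
    let χ : ContDiffBump ((a + b) / 2 : ℝ) :=
      ⟨(b - a) / 4, (b - a) / 3, by linarith, by linarith⟩
    have hts : tsupport (χ.normed volume) ⊆ Ioo a b := by
      rw [χ.tsupport_normed_eq]
      intro x hx
      rw [Metric.mem_closedBall, Real.dist_eq, abs_le] at hx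
      change -((b - a) / 3) ≤ _ ∧ _ ≤ (b - a) / 3 at hx
      constructor <;> linarith [hx.1, hx.2]
    refine ⟨χ.normed volume, ⟨χ.contDiff_normed, χ.hasCompactSupport_normed, hts⟩, ?_⟩
    rw [intervalIntegral.integral_eq_integral_of_support_subset, χ.integral_normed]
    exact (subset_tsupport _).trans (hts.trans Ioo_subset_Ioc_self)
  let R : LrI r a b := (hρ.memLp _).toLp
  have hR : (R : ℝ → ℝ) =ᵐ[volume.restrict (Ioo a b)] ρ := MemLp.coeFn_toLp _
  let D : Set (LrI r a b) := {f | ∃ g, IsTestFun a b g ∧ f =ᵐ[volume.restrict (Ioo a b)] g}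
  have hv' : hv.toLp ∈ closure D := by
    refine (mem_closure_iff_nhds_basis Metric.nhds_basis_closedBall).2 fun ε hε => ?_
    obtain ⟨g, hg, hle⟩ := exists_isTestFun_eLpNorm_sub_le hab hv hε
    refine ⟨(hg.memLp _).toLp, ⟨g, hg, MemLp.coeFn_toLp _⟩, ?_⟩
    rw [Metric.mem_closedBall, dist_comm, dist_eq_norm, ← MemLp.toLp_sub, Lp.norm_toLp]
    exact ENNReal.toReal_le_of_le_ofReal hε.le hle
  -- Subtracting `(∫ f) ρ`, with `∫ ρ = 1`, makes the mean zero, preserves test functions and fixes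
  -- functions that already have mean zero. Density in `L^r` thus yields density among mean-zero
  -- functions.
  let Q : LrI r a b → LrI r a b := fun f => f - I f • R
  have hQc : Continuous Q := by fun_prop
  let F : LrI r a b → LrI r a b × LrI r a b := fun f => (P (Q f), Q f)
  have hFc : Continuous F := by fun_prop
  have hF : MapsTo F D (testGraph r a b) := by
    rintro f ⟨g, hg, hfg⟩
    have hg1 : IsTestFun a b (fun x => g x - I f * ρ x) := by
      refine ⟨hg.smooth.sub (contDiff_const.mul hρ.smooth),
        hg.hasCompactSupport.sub hρ.hasCompactSupport.mul_left, ?_⟩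
      refine (tsupport_sub g _).trans (union_subset hg.tsupport_subset ?_)
      exact tsupport_mul_subset_right.trans hρ.tsupport_subset
    have hIf : I f = ∫ t in a..b, g t := (hI f).trans (intervalIntegral_congr_Ioo hfg hl hr)
    have hg0 : ∫ t in a..b, (g t - I f * ρ t) = 0 := by
      rw [intervalIntegral.integral_sub (hg.smooth.continuous.intervalIntegrable _ _)
        ((hρ.smooth.continuous.const_mul (I f)).intervalIntegrable _ _),
        intervalIntegral.integral_const_mul, hρ1, hIf]
      ring
    have hQ : (Q f : ℝ → ℝ) =ᵐ[volume.restrict (Ioo a b)] fun x => g x - I f * ρ x := by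
      filter_upwards [Lp.coeFn_sub f (I f • R), LrI.coeFn_smul_ae (I f) R, hR, hfg]
        with x h1 h2 h3 h4
      change (f - I f • R : LrI r a b) x = _
      rw [h1, Pi.sub_apply, h2, h3, h4]
    obtain ⟨hp1, hp2⟩ := hg1.primitive hab hg0
    refine ⟨_, hp1, ?_, ?_⟩
    · filter_upwards [hP (Q f), hm] with x hx hx'
      exact hx.trans (intervalIntegral_congr_Ioo hQ hl hx')
    · rw [hp2]
      exact hQ
  have hmem := map_mem_closure hFc hv' hF
  have hIv : I hv.toLp = 0 := by
    rw [hI, intervalIntegral_congr_Ioo hv.coeFn_toLp hl hr, h0]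
  have hQv : Q hv.toLp = hv.toLp := by simp only [Q, hIv, zero_smul, sub_zero]
  refine ⟨⟨F hv.toLp, hmem⟩, ?_, ?_⟩
  · change (Q hv.toLp : ℝ → ℝ) =ᵐ[volume.restrict (Ioo a b)] v
    rw [hQv]
    exact hv.coeFn_toLp
  · change (P (Q hv.toLp) : ℝ → ℝ) =ᵐ[volume.restrict (Ioo a b)] _
    rw [hQv]
    filter_upwards [hP hv.toLp, hm] with x hx hx'
    exact hx.trans (intervalIntegral_congr_Ioo hv.coeFn_toLp hl hx')

end

/-! ### Disjoint translates and the second eigenvalue as a Poincaré constant -/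

section

/-- Interval integrability is the form that survives translation and rescaling; the first conjunct
on the right supplies measurability. -/
lemma memLp_Ioo_iff {r c d : ℝ} (hr : 1 < r) (hcd : c ≤ d) {v : ℝ → ℝ} :
    MemLp v (ENNReal.ofReal r) (volume.restrict (Ioo c d)) ↔
      IntervalIntegrable v volume c d ∧ IntervalIntegrable (fun x => |v x| ^ r) volume c d := by
  have h0 : ENNReal.ofReal r ≠ 0 := by
    rw [Ne, ENNReal.ofReal_eq_zero]; linarith
  rw [intervalIntegrable_iff_integrableOn_Ioo_of_le hcd,
    intervalIntegrable_iff_integrableOn_Ioo_of_le hcd, IntegrableOn, IntegrableOn]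
  have key : ∀ h : AEStronglyMeasurable v (volume.restrict (Ioo c d)),
      Integrable (fun x => |v x| ^ r) (volume.restrict (Ioo c d)) ↔
        MemLp v (ENNReal.ofReal r) (volume.restrict (Ioo c d)) := fun h => by
    rw [← integrable_norm_rpow_iff h h0 ENNReal.ofReal_ne_top,
      ENNReal.toReal_ofReal (by linarith)]
    rfl
  constructor
  · intro h
    exact ⟨h.integrable (by simpa using ENNReal.ofReal_le_ofReal hr.le),
      (key h.aestronglyMeasurable).2 h⟩
  · rintro ⟨h1, h2⟩
    exact (key h1.aestronglyMeasurable).1 h2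

lemma continuousOn_primitive_Icc {c d : ℝ} (hcd : c ≤ d) {v : ℝ → ℝ}
    (hv : IntervalIntegrable v volume c d) :
    ContinuousOn (fun x => ∫ t in c..x, v t) (Icc c d) := by
  have := intervalIntegral.continuousOn_primitive_interval' hv left_mem_uIcc
  rwa [uIcc_of_le hcd] at this

lemma integral_Ioo_abs_indicator_rpow {r a b c d : ℝ} (hr : 1 < r) (hac : a ≤ c) (hcd : c ≤ d)
    (hdb : d ≤ b) {f g : ℝ → ℝ}
    (h : f =ᵐ[volume.restrict (Ioo a b)] (Ioo c d).indicator g) :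
    ∫ x in Ioo a b, |f x| ^ r = ∫ x in c..d, |g x| ^ r := by
  have h1 : ∫ x in Ioo a b, |f x| ^ r =
      ∫ x in Ioo a b, (Ioo c d).indicator (fun x => |g x| ^ r) x := by
    refine integral_congr_ae ?_
    filter_upwards [h] with x hx
    rw [hx]
    by_cases hx' : x ∈ Ioo c d
    · simp [hx']
    · simp [hx', Real.zero_rpow (by linarith : r ≠ 0)]
  rw [h1, setIntegral_indicator measurableSet_Ioo,
    inter_eq_self_of_subset_right (Ioo_subset_Ioo hac hdb), intervalIntegral.integral_of_le hcd,
    integral_Ioc_eq_integral_Ioo]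

variable {r a b : ℝ} [Fact (1 < r)]

lemma LrI.norm_rpow (f : LrI r a b) : ‖f‖ ^ r = ∫ x in Ioo a b, |f x| ^ r := by
  have hr : 1 < r := Fact.out
  have h0 : ENNReal.ofReal r ≠ 0 := by
    rw [Ne, ENNReal.ofReal_eq_zero]; linarith
  have hI : 0 ≤ ∫ x in Ioo a b, |f x| ^ r := integral_nonneg fun x => by positivity
  rw [Lp.norm_def, (Lp.memLp f).eLpNorm_eq_integral_rpow_norm h0 ENNReal.ofReal_ne_top,
    ENNReal.toReal_ofReal (by linarith : (0 : ℝ) ≤ r)]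
  simp only [Real.norm_eq_abs]
  rw [ENNReal.toReal_ofReal (by positivity), ← Real.rpow_mul hI, inv_mul_cancel₀ (by linarith),
    Real.rpow_one]

lemma LrI.integrable_abs_rpow (f : LrI r a b) :
    Integrable (fun x => |f x| ^ r) (volume.restrict (Ioo a b)) := by
  have hr : 1 < r := Fact.out
  have := (Lp.memLp f).integrable_norm_rpow (by rw [Ne, ENNReal.ofReal_eq_zero]; linarith)
    ENNReal.ofReal_ne_top
  rwa [ENNReal.toReal_ofReal (by linarith)] at this

lemma LrI.norm_rpow_add_of_disjoint {f g : LrI r a b}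
    (h : ∀ᵐ x ∂(volume.restrict (Ioo a b)), f x = 0 ∨ g x = 0) (s t : ℝ) :
    ‖s • f + t • g‖ ^ r = |s| ^ r * ‖f‖ ^ r + |t| ^ r * ‖g‖ ^ r := by
  have hr : 1 < r := Fact.out
  have h0 : (0 : ℝ) ^ r = 0 := Real.zero_rpow (by linarith)
  rw [LrI.norm_rpow, LrI.norm_rpow, LrI.norm_rpow, ← integral_const_mul, ← integral_const_mul,
    ← integral_add (f.integrable_abs_rpow.const_mul _) (g.integrable_abs_rpow.const_mul _)]
  refine integral_congr_ae ?_
  filter_upwards [h, LrI.coeFn_add_ae (s • f) (t • g), LrI.coeFn_smul_ae s f,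
    LrI.coeFn_smul_ae t g] with x hx h1 h2 h3
  rw [h1, h2, h3]
  rcases hx with hx | hx <;> simp [hx, h0, abs_mul, Real.mul_rpow]

/-- Extension by zero of an element of `W_0^{1,r}(c, d)` to `(a, b)`. -/
lemma W0.exists_extension {c d : ℝ} (hac : a ≤ c) (hcd : c < d) (hdb : d ≤ b) {v : ℝ → ℝ}
    (hv : IntervalIntegrable v volume c d)
    (hvr : IntervalIntegrable (fun x => |v x| ^ r) volume c d) (h0 : ∫ t in c..d, v t = 0) :
    ∃ u : W0 r a b,
      (W0.grad u : ℝ → ℝ) =ᵐ[volume.restrict (Ioo a b)] (Ioo c d).indicator v ∧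
      (W0.val u : ℝ → ℝ) =ᵐ[volume.restrict (Ioo a b)]
        (Ioo c d).indicator (fun x => ∫ t in c..x, v t) := by
  have hr : 1 < r := Fact.out
  have hab : a < b := hac.trans_lt (hcd.trans_le hdb)
  have hm : MemLp ((Ioo c d).indicator v) (ENNReal.ofReal r) (volume.restrict (Ioo a b)) := by
    rw [memLp_indicator_iff_restrict measurableSet_Ioo, Measure.restrict_restrict measurableSet_Ioo,
      inter_eq_self_of_subset_left (Ioo_subset_Ioo hac hdb)]
    exact (memLp_Ioo_iff hr hcd.le).2 ⟨hv, hvr⟩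
  have hint : ∀ {x y}, x ∈ Icc a b → y ∈ Icc a b →
      IntervalIntegrable ((Ioo c d).indicator v) volume x y := fun hx hy =>
    intervalIntegrable_of_integrable_Ioo
      (hm.integrable (by simpa using ENNReal.ofReal_le_ofReal hr.le)) hx hy
  have hzero : ∀ x y, (∀ t ∈ uIcc x y, t ∉ Ioo c d) →
      ∫ t in x..y, (Ioo c d).indicator v t = 0 := fun x y h =>
    (intervalIntegral.integral_congr (g := fun _ => 0)
      fun t ht => indicator_of_notMem (h t ht) v).trans (by simp)
  have hmid : ∀ x ∈ Icc c d, ∫ t in c..x, (Ioo c d).indicator v t = ∫ t in c..x, v t := by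
    intro x hx
    rw [intervalIntegral.integral_of_le hx.1, intervalIntegral.integral_of_le hx.1,
      integral_Ioc_eq_integral_Ioo, integral_Ioc_eq_integral_Ioo]
    refine setIntegral_congr_fun measurableSet_Ioo fun t ht => ?_
    exact indicator_of_mem (show t ∈ Ioo c d from ⟨ht.1, ht.2.trans_le hx.2⟩) v
  have haI : a ∈ Icc a b := left_mem_Icc.2 hab.le
  have hcI : c ∈ Icc a b := ⟨hac, hcd.le.trans hdb⟩
  have hdI : d ∈ Icc a b := ⟨hac.trans hcd.le, hdb⟩
  have hac0 : ∫ t in a..c, (Ioo c d).indicator v t = 0 := hzero _ _ fun t ht ht' => by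
    rw [uIcc_of_le hac] at ht; linarith [ht.2, ht'.1]
  have hpr : ∀ x ∈ Icc a b, ∫ t in a..x, (Ioo c d).indicator v t =
      (Ioo c d).indicator (fun x => ∫ t in c..x, v t) x := by
    intro x hx
    rw [← intervalIntegral.integral_add_adjacent_intervals (hint haI hcI) (hint hcI hx), hac0,
      zero_add]
    rcases le_or_gt x c with h | h
    · rw [indicator_of_notMem (fun hx' => absurd hx'.1 (not_lt.2 h))]
      exact hzero _ _ fun t ht ht' => by
        rw [uIcc_of_ge h] at ht; linarith [ht.2, ht'.1]
    rcases lt_or_ge x d with h' | h'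
    · rw [hmid x ⟨h.le, h'.le⟩, indicator_of_mem (show x ∈ Ioo c d from ⟨h, h'⟩)]
    · rw [indicator_of_notMem (fun hx' => absurd hx'.2 (not_lt.2 h')),
        ← intervalIntegral.integral_add_adjacent_intervals (hint hcI hdI) (hint hdI hx),
        hmid d (right_mem_Icc.2 hcd.le), h0, zero_add]
      exact hzero _ _ fun t ht ht' => by
        rw [uIcc_of_le h'] at ht; linarith [ht.1, ht'.2]
  obtain ⟨u, hu1, hu2⟩ := W0.exists_of_integral_eq_zero hab hm
    ((hpr b (right_mem_Icc.2 hab.le)).trans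
      (indicator_of_notMem (fun hx' => absurd hx'.2 (not_lt.2 hdb)) _))
  refine ⟨u, hu1, hu2.trans ?_⟩
  filter_upwards [ae_restrict_mem measurableSet_Ioo] with x hx
  exact hpr x (Ioo_subset_Icc_self hx)

/-- The translate by `τ` of an element of `W_0^{1,r}(c, d)`, extended by zero to `(a, b)`. -/
lemma W0.exists_translate {c d τ : ℝ} (hac : a ≤ c + τ) (hcd : c < d) (hdb : d + τ ≤ b)
    {v : ℝ → ℝ} (hv : IntervalIntegrable v volume c d)
    (hvr : IntervalIntegrable (fun x => |v x| ^ r) volume c d) (h0 : ∫ t in c..d, v t = 0) :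
    ∃ u : W0 r a b,
      (∀ᵐ x ∂(volume.restrict (Ioo a b)), x ∉ Ioo (c + τ) (d + τ) →
        W0.val u x = 0 ∧ W0.grad u x = 0) ∧
      ‖W0.grad u‖ ^ r = (∫ x in c..d, |v x| ^ r) ∧
      ‖W0.val u‖ ^ r = ∫ x in c..d, |∫ t in c..x, v t| ^ r := by
  have hr : 1 < r := Fact.out
  obtain ⟨u, h1, h2⟩ := W0.exists_extension (r := r) hac (add_lt_add_left hcd τ) hdb
    (v := fun x => v (x - τ)) (hv.comp_sub_right τ) (hvr.comp_sub_right τ) (by simpa using h0)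
  refine ⟨u, ?_, ?_, ?_⟩
  · filter_upwards [h1, h2] with x hx1 hx2 hx
    rw [hx1, hx2]
    simp [hx]
  · rw [LrI.norm_rpow, integral_Ioo_abs_indicator_rpow hr hac (by linarith) hdb h1,
      intervalIntegral.integral_comp_sub_right (fun x => |v x| ^ r)]
    simp
  · rw [LrI.norm_rpow, integral_Ioo_abs_indicator_rpow hr hac (by linarith) hdb h2]
    simp only [intervalIntegral.integral_comp_sub_right, add_sub_cancel_right]
    rw [intervalIntegral.integral_comp_sub_right (fun x => |∫ t in c..x, v t| ^ r)]
    simp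

/-- A pair of disjointly supported elements of `W_0^{1,r}(a, b)` with the same norms bounds the
second eigenvalue by their common Rayleigh quotient. -/
lemma eigenvalue_two_le_of_disjoint {u₁ u₂ : W0 r a b}
    (hval : ∀ᵐ x ∂(volume.restrict (Ioo a b)), W0.val u₁ x = 0 ∨ W0.val u₂ x = 0)
    (hgrad : ∀ᵐ x ∂(volume.restrict (Ioo a b)), W0.grad u₁ x = 0 ∨ W0.grad u₂ x = 0)
    {A B : ℝ} (hA : 0 < A) (h1 : ‖W0.val u₁‖ ^ r = A) (h2 : ‖W0.val u₂‖ ^ r = A)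
    (h3 : ‖W0.grad u₁‖ ^ r = B) (h4 : ‖W0.grad u₂‖ ^ r = B) :
    eigenvalue 2 r a b ≤ B / A := by
  have hr : 1 < r := Fact.out
  let S := Metric.sphere (0 : EuclideanSpace ℝ (Fin 2)) 1
  let w : S → W0 r a b := fun z => z.1 0 • u₁ + z.1 1 • u₂
  have hwc : Continuous w := by fun_prop
  -- By disjointness of supports, `‖w z‖_r^r` and `‖(w z)'‖_r^r` carry the same factor `σ z`, so the
  -- Rayleigh quotient is constant along the circle.
  let σ : S → ℝ := fun z => |z.1 0| ^ r + |z.1 1| ^ r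
  have hσ : ∀ z, 0 < σ z := by
    intro z
    have hz : z.1 ≠ 0 := fun h => by
      have := z.2
      rw [mem_sphere_zero_iff_norm, h, norm_zero] at this
      exact zero_ne_one this
    have : z.1 0 ≠ 0 ∨ z.1 1 ≠ 0 := by
      by_contra! hc
      refine hz ?_
      ext i
      fin_cases i
      · exact hc.1
      · exact hc.2
    rcases this with h | h
    · exact add_pos_of_pos_of_nonneg (Real.rpow_pos_of_pos (abs_pos.2 h) r) (by positivity)
    · exact add_pos_of_nonneg_of_pos (by positivity) (Real.rpow_pos_of_pos (abs_pos.2 h) r)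
  have hwv : ∀ z, ‖W0.val (w z)‖ ^ r = σ z * A := fun z =>
    (LrI.norm_rpow_add_of_disjoint hval _ _).trans (by rw [h1, h2]; ring)
  have hwg : ∀ z, ‖W0.grad (w z)‖ ^ r = σ z * B := fun z =>
    (LrI.norm_rpow_add_of_disjoint hgrad _ _).trans (by rw [h3, h4]; ring)
  have hpos : ∀ z, 0 < ‖W0.val (w z)‖ := fun z => by
    refine (norm_nonneg _).lt_of_ne' fun h => ?_
    have := hwv z
    rw [h, Real.zero_rpow (by linarith)] at this
    exact absurd this (mul_pos (hσ z) hA).ne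
  have hNc : Continuous fun z => ‖W0.val (w z)‖ := by
    have : Continuous fun z => ‖((w z : LrI r a b × LrI r a b)).1‖ := by fun_prop
    exact this
  have hmem : ∀ z, ‖W0.val (w z)‖⁻¹ • w z ∈ unitLr r a b := fun z => by
    change ‖‖W0.val (w z)‖⁻¹ • W0.val (w z)‖ = 1
    rw [norm_smul, norm_inv, norm_norm, inv_mul_cancel₀ (hpos z).ne']
  have hc : Continuous fun z => ‖W0.val (w z)‖⁻¹ • w z :=
    (hNc.inv₀ fun z => (hpos z).ne').smul hwc
  let h : C(S, unitLr r a b) := ⟨fun z => ⟨_, hmem z⟩, hc.subtype_mk hmem⟩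
  have hwneg : ∀ z : S, w (-z) = -w z := fun z => by
    have e0 : (-z).1 0 = -(z.1 0) := rfl
    have e1 : (-z).1 1 = -(z.1 1) := rfl
    simp only [w, e0, e1]
    module
  have hodd : ∀ z, (h (-z) : W0 r a b) = -(h z : W0 r a b) := fun z => by
    change ‖W0.val (w (-z))‖⁻¹ • w (-z) = -(‖W0.val (w z)‖⁻¹ • w z)
    rw [hwneg, smul_neg]
    congr 3
    exact norm_neg (W0.val (w z))
  have hconst : ∀ z, ‖W0.grad (h z : W0 r a b)‖ ^ r = B / A := fun z => by
    change ‖‖W0.val (w z)‖⁻¹ • W0.grad (w z)‖ ^ r = B / A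
    rw [norm_smul, norm_inv, norm_norm, Real.mul_rpow (by positivity) (norm_nonneg _),
      Real.inv_rpow (norm_nonneg _), hwv, hwg]
    have := (hσ z).ne'
    field_simp
  have hne : Nonempty S := ⟨⟨EuclideanSpace.single 0 1, by simp [S]⟩⟩
  refine csInf_le ⟨0, ?_⟩ ⟨h, hodd, ?_⟩
  · rintro M ⟨g, -, ⟨z, rfl⟩, -⟩
    positivity
  · exact ⟨⟨hne.some, hconst _⟩, by rintro _ ⟨z, rfl⟩; exact (hconst z).le⟩

/-- The second eigenvalue of `(a, b)` is a Poincaré constant for every interval of at most half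
the length. -/
theorem eigenvalue_two_mul_integral_le {c d : ℝ} (hcd : c < d) (hL : d - c ≤ (b - a) / 2)
    {v : ℝ → ℝ} (hv : IntervalIntegrable v volume c d)
    (hvr : IntervalIntegrable (fun x => |v x| ^ r) volume c d) (h0 : ∫ t in c..d, v t = 0) :
    eigenvalue 2 r a b * (∫ x in c..d, |∫ t in c..x, v t| ^ r) ≤ ∫ x in c..d, |v x| ^ r := by
  have hB : 0 ≤ ∫ x in c..d, |v x| ^ r :=
    intervalIntegral.integral_nonneg hcd.le fun x _ => by positivity
  have hA : 0 ≤ ∫ x in c..d, |∫ t in c..x, v t| ^ r :=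
    intervalIntegral.integral_nonneg hcd.le fun x _ => by positivity
  rcases hA.eq_or_lt with hA | hA
  · rw [← hA, mul_zero]; exact hB
  -- The translates occupy `(a, a + (d - c))` and `(a + (d - c), a + 2(d - c))`; the second fits
  -- because `2(d - c) ≤ b - a`.
  obtain ⟨u₁, hz1, hg1, hv1⟩ := W0.exists_translate (r := r) (a := a) (b := b) (τ := a - c)
    (by linarith) hcd (by linarith) hv hvr h0
  obtain ⟨u₂, hz2, hg2, hv2⟩ := W0.exists_translate (r := r) (a := a) (b := b) (τ := a + d - 2 * c)
    (by linarith) hcd (by linarith) hv hvr h0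
  have hdisj : ∀ x, x ∉ Ioo (c + (a - c)) (d + (a - c)) ∨
      x ∉ Ioo (c + (a + d - 2 * c)) (d + (a + d - 2 * c)) := fun x => by
    by_contra! h
    linarith [h.1.2, h.2.1]
  rw [← le_div_iff₀ hA]
  refine eigenvalue_two_le_of_disjoint (u₁ := u₁) (u₂ := u₂) ?_ ?_ hA hv1 hv2 hg1 hg2
  · filter_upwards [hz1, hz2] with x h1 h2
    exact (hdisj x).imp (fun h => (h1 h).1) fun h => (h2 h).1
  · filter_upwards [hz1, hz2] with x h1 h2
    exact (hdisj x).imp (fun h => (h1 h).2) fun h => (h2 h).2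

end

/-! ### Inner variations and the first integral of an extremal -/

section

lemma intervalIntegrable_comp_mul_add {f : ℝ → ℝ} {k m p q : ℝ} (hk : 0 < k)
    (hf : IntervalIntegrable f volume (k * p + m) (k * q + m)) :
    IntervalIntegrable (fun y => f (k * y + m)) volume p q := by
  have h := (hf.comp_add_right m).comp_mul_left (c := k)
  simpa [mul_div_cancel_left₀ _ hk.ne'] using h

/-- A Poincaré inequality on `(c, d)`, tested with a function rescaled by the factors `1 / k` and
`1 / k'` on the two sides of a point `x`. -/
lemma poincare_comp_piecewise_affine {r lam c d x y k k' m m' : ℝ} (hr : 1 < r)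
    (hk : 0 < k) (hk' : 0 < k') (hcy : c ≤ y) (hyd : y ≤ d) (hcx : c ≤ x) (hxd : x ≤ d)
    (h1 : k * c + m = c) (h2 : k * y + m = x) (h3 : k' * y + m' = x) (h4 : k' * d + m' = d)
    {v : ℝ → ℝ} (hv : IntervalIntegrable v volume c d)
    (hvr : IntervalIntegrable (fun x => |v x| ^ r) volume c d) (h0 : ∫ t in c..d, v t = 0)
    (hP : ∀ w : ℝ → ℝ, IntervalIntegrable w volume c d →
      IntervalIntegrable (fun x => |w x| ^ r) volume c d → ∫ t in c..d, w t = 0 →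
      lam * (∫ x in c..d, |∫ t in c..x, w t| ^ r) ≤ ∫ x in c..d, |w x| ^ r) :
    lam * (k⁻¹ * (∫ x in c..x, |∫ t in c..x, v t| ^ r) +
        k'⁻¹ * ∫ x in x..d, |∫ t in c..x, v t| ^ r) ≤
      k ^ (r - 1) * (∫ x in c..x, |v x| ^ r) + k' ^ (r - 1) * ∫ x in x..d, |v x| ^ r := by
  have hcd : c ≤ d := hcx.trans hxd
  have hxI : x ∈ uIcc c d := by rw [uIcc_of_le hcd]; exact ⟨hcx, hxd⟩
  have sub1 : uIcc c x ⊆ uIcc c d := uIcc_subset_uIcc left_mem_uIcc hxI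
  have sub2 : uIcc x d ⊆ uIcc c d := uIcc_subset_uIcc hxI right_mem_uIcc
  -- The derivative of `V ∘ θ`, where `V` is the primitive of `v` and `θ` is the piecewise affine
  -- map fixing `c` and `d` and sending `y` to `x`.
  let w : ℝ → ℝ := fun z => if z ≤ y then k * v (k * z + m) else k' * v (k' * z + m')
  have hw1 : ∀ z ∈ Ioc c y, w z = k * v (k * z + m) := fun z hz => if_pos hz.2
  have hw2 : ∀ z ∈ Ioc y d, w z = k' * v (k' * z + m') := fun z hz => if_neg (not_le.2 hz.1)
  have iA1 : ∀ {f : ℝ → ℝ}, IntervalIntegrable f volume c d →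
      IntervalIntegrable (fun z => f (k * z + m)) volume c y := fun hf =>
    intervalIntegrable_comp_mul_add hk (by rw [h1, h2]; exact hf.mono_set sub1)
  have iA2 : ∀ {f : ℝ → ℝ}, IntervalIntegrable f volume c d →
      IntervalIntegrable (fun z => f (k' * z + m')) volume y d := fun hf =>
    intervalIntegrable_comp_mul_add hk' (by rw [h3, h4]; exact hf.mono_set sub2)
  have iw1 : IntervalIntegrable w volume c y :=
    ((iA1 hv).const_mul k).congr (fun z hz => by
      rw [uIoc_of_le hcy] at hz; exact (hw1 z hz).symm)
  have iw2 : IntervalIntegrable w volume y d :=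
    ((iA2 hv).const_mul k').congr (fun z hz => by
      rw [uIoc_of_le hyd] at hz; exact (hw2 z hz).symm)
  have eabs1 : ∀ z ∈ Ioc c y, |w z| ^ r = k ^ r * |v (k * z + m)| ^ r := fun z hz => by
    rw [hw1 z hz, abs_mul, abs_of_pos hk, Real.mul_rpow hk.le (abs_nonneg _)]
  have eabs2 : ∀ z ∈ Ioc y d, |w z| ^ r = k' ^ r * |v (k' * z + m')| ^ r := fun z hz => by
    rw [hw2 z hz, abs_mul, abs_of_pos hk', Real.mul_rpow hk'.le (abs_nonneg _)]
  have iwr1 : IntervalIntegrable (fun z => |w z| ^ r) volume c y :=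
    ((iA1 hvr).const_mul (k ^ r)).congr (fun z hz => by
      rw [uIoc_of_le hcy] at hz; exact (eabs1 z hz).symm)
  have iwr2 : IntervalIntegrable (fun z => |w z| ^ r) volume y d :=
    ((iA2 hvr).const_mul (k' ^ r)).congr (fun z hz => by
      rw [uIoc_of_le hyd] at hz; exact (eabs2 z hz).symm)
  have W1 : ∀ z ∈ Icc c y, ∫ t in c..z, w t = ∫ t in c..k * z + m, v t := fun z hz => by
    have : ∫ t in c..z, w t = ∫ t in c..z, k * v (k * t + m) := by
      refine intervalIntegral.integral_congr_ae (Filter.Eventually.of_forall fun t ht => ?_)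
      rw [uIoc_of_le hz.1] at ht
      exact hw1 t ⟨ht.1, ht.2.trans hz.2⟩
    rw [this, intervalIntegral.integral_const_mul, intervalIntegral.integral_comp_mul_add v hk.ne' m,
      h1, smul_eq_mul, mul_inv_cancel_left₀ hk.ne']
  have W2 : ∀ z ∈ Icc y d, ∫ t in c..z, w t = ∫ t in c..k' * z + m', v t := fun z hz => by
    have e : ∫ t in y..z, w t = ∫ t in y..z, k' * v (k' * t + m') := by
      refine intervalIntegral.integral_congr_ae (Filter.Eventually.of_forall fun t ht => ?_)
      rw [uIoc_of_le hz.1] at ht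
      exact hw2 t ⟨ht.1, ht.2.trans hz.2⟩
    have hzI : k' * z + m' ∈ Icc x d := by
      constructor
      · rw [← h3]; gcongr; exact hz.1
      · rw [← h4]; gcongr; exact hz.2
    rw [← intervalIntegral.integral_add_adjacent_intervals iw1
      (iw2.mono_set (uIcc_subset_uIcc left_mem_uIcc (by rwa [uIcc_of_le hyd]))),
      W1 y (right_mem_Icc.2 hcy), h2, e, intervalIntegral.integral_const_mul,
      intervalIntegral.integral_comp_mul_add v hk'.ne' m',
      h3, smul_eq_mul, mul_inv_cancel_left₀ hk'.ne',
      intervalIntegral.integral_add_adjacent_intervals (hv.mono_set sub1)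
        (hv.mono_set ((uIcc_subset_uIcc left_mem_uIcc (by rwa [uIcc_of_le hxd])).trans sub2))]
  have hVc : IntervalIntegrable (fun x => |∫ t in c..x, v t| ^ r) volume c d := by
    refine ContinuousOn.intervalIntegrable ?_
    rw [uIcc_of_le hcd]
    exact (continuousOn_primitive_Icc hcd hv).abs.rpow_const fun _ _ => Or.inr (by linarith)
  have hw0 : ∫ t in c..d, w t = 0 := by
    rw [W2 d (right_mem_Icc.2 hyd), h4, h0]
  have key := hP w (iw1.trans iw2) (iwr1.trans iwr2) hw0
  have E1 : ∫ z in c..y, |w z| ^ r = k ^ (r - 1) * ∫ z in c..x, |v z| ^ r := by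
    rw [intervalIntegral.integral_congr_ae (g := fun z => k ^ r * |v (k * z + m)| ^ r)
      (Filter.Eventually.of_forall fun z hz => eabs1 z (by rwa [uIoc_of_le hcy] at hz)),
      intervalIntegral.integral_const_mul,
      intervalIntegral.integral_comp_mul_add (fun z => |v z| ^ r) hk.ne' m, h1, h2, smul_eq_mul,
      ← mul_assoc, Real.rpow_sub_one hk.ne', div_eq_mul_inv]
  have E2 : ∫ z in y..d, |w z| ^ r = k' ^ (r - 1) * ∫ z in x..d, |v z| ^ r := by
    rw [intervalIntegral.integral_congr_ae (g := fun z => k' ^ r * |v (k' * z + m')| ^ r)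
      (Filter.Eventually.of_forall fun z hz => eabs2 z (by rwa [uIoc_of_le hyd] at hz)),
      intervalIntegral.integral_const_mul,
      intervalIntegral.integral_comp_mul_add (fun z => |v z| ^ r) hk'.ne' m', h3, h4, smul_eq_mul,
      ← mul_assoc, Real.rpow_sub_one hk'.ne', div_eq_mul_inv]
  have G1 : EqOn (fun z => |∫ t in c..z, w t| ^ r) (fun z => |∫ t in c..k * z + m, v t| ^ r)
      (uIcc c y) := fun z hz => by
    rw [uIcc_of_le hcy] at hz
    simp only [W1 z hz]
  have G2 : EqOn (fun z => |∫ t in c..z, w t| ^ r) (fun z => |∫ t in c..k' * z + m', v t| ^ r)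
      (uIcc y d) := fun z hz => by
    rw [uIcc_of_le hyd] at hz
    simp only [W2 z hz]
  have F1 : ∫ z in c..y, |∫ t in c..z, w t| ^ r = k⁻¹ * ∫ z in c..x, |∫ t in c..z, v t| ^ r := by
    rw [intervalIntegral.integral_congr G1,
      intervalIntegral.integral_comp_mul_add (fun z => |∫ t in c..z, v t| ^ r) hk.ne' m, h1, h2,
      smul_eq_mul]
  have F2 : ∫ z in y..d, |∫ t in c..z, w t| ^ r = k'⁻¹ * ∫ z in x..d, |∫ t in c..z, v t| ^ r := by
    rw [intervalIntegral.integral_congr G2,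
      intervalIntegral.integral_comp_mul_add (fun z => |∫ t in c..z, v t| ^ r) hk'.ne' m', h3, h4,
      smul_eq_mul]
  have J1 : IntervalIntegrable (fun z => |∫ t in c..z, w t| ^ r) volume c y :=
    (iA1 hVc).congr fun z hz => (G1 (uIoc_subset_uIcc hz)).symm
  have J2 : IntervalIntegrable (fun z => |∫ t in c..z, w t| ^ r) volume y d :=
    (iA2 hVc).congr fun z hz => (G2 (uIoc_subset_uIcc hz)).symm
  rwa [← intervalIntegral.integral_add_adjacent_intervals J1 J2,
    ← intervalIntegral.integral_add_adjacent_intervals iwr1 iwr2, E1, E2, F1, F2] at key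

/-- Stationarity of the Rayleigh quotient under the inner variations that are affine on both sides
of `x`. -/
lemma poincare_extremal_stationary {r lam c d x : ℝ} (hr : 1 < r) (hx : x ∈ Ioo c d)
    {v : ℝ → ℝ} (hv : IntervalIntegrable v volume c d)
    (hvr : IntervalIntegrable (fun x => |v x| ^ r) volume c d) (h0 : ∫ t in c..d, v t = 0)
    (hP : ∀ w : ℝ → ℝ, IntervalIntegrable w volume c d →
      IntervalIntegrable (fun x => |w x| ^ r) volume c d → ∫ t in c..d, w t = 0 →
      lam * (∫ x in c..d, |∫ t in c..x, w t| ^ r) ≤ ∫ x in c..d, |w x| ^ r)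
    {P₁ P₂ Q₁ Q₂ : ℝ} (hP₁ : ∫ x in c..x, |v x| ^ r = P₁) (hP₂ : ∫ x in x..d, |v x| ^ r = P₂)
    (hQ₁ : ∫ x in c..x, |∫ t in c..x, v t| ^ r = Q₁)
    (hQ₂ : ∫ x in x..d, |∫ t in c..x, v t| ^ r = Q₂)
    (heq : lam * (Q₁ + Q₂) = P₁ + P₂) :
    ((r - 1) * P₁ + lam * Q₁) * (d - x) = ((r - 1) * P₂ + lam * Q₂) * (x - c) := by
  obtain ⟨hcx, hxd⟩ := hx
  have l1 : 0 < x - c := sub_pos.2 hcx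
  have l2 : 0 < d - x := sub_pos.2 hxd
  -- The defect in the Poincaré inequality when `x` is moved to `x + t`, which stretches the left
  -- piece by `1 + t / (x - c)` and the right one by `1 - t / (d - x)`. It is nonnegative and
  -- vanishes at `t = 0`, so its derivative there is zero.
  let F : ℝ → ℝ := fun t => (1 + t / (x - c)) ^ (1 - r) * P₁ + (1 - t / (d - x)) ^ (1 - r) * P₂
    - lam * ((1 + t / (x - c)) * Q₁ + (1 - t / (d - x)) * Q₂)
  have hF0 : F 0 = 0 := by
    simp only [F, zero_div, add_zero, sub_zero, Real.one_rpow, one_mul]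
    linarith
  have hFnonneg : ∀ t, -(x - c) < t → t < d - x → 0 ≤ F t := by
    intro t ht1 ht2
    have hs : 0 < 1 + t / (x - c) := by
      rw [← neg_lt_iff_pos_add', lt_div_iff₀ l1]; linarith
    have hs' : 0 < 1 - t / (d - x) := by
      rw [sub_pos, div_lt_one l2]; exact ht2
    set s := 1 + t / (x - c) with hsdef
    set s' := 1 - t / (d - x) with hsdef'
    have es : s * (x - c) = x - c + t := by rw [hsdef]; field_simp
    have es' : s' * (d - x) = d - x - t := by rw [hsdef']; field_simp
    have key := poincare_comp_piecewise_affine (x := x) (y := x + t) (k := s⁻¹) (k' := s'⁻¹)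
      (m := c - s⁻¹ * c) (m' := d - s'⁻¹ * d) hr (inv_pos.2 hs) (inv_pos.2 hs')
      (by linarith) (by linarith) hcx.le hxd.le (by ring)
      (by
        have : x + t = c + s * (x - c) := by linarith
        rw [this]; field_simp; ring)
      (by
        have : x + t = d - s' * (d - x) := by linarith
        rw [this]; field_simp; ring)
      (by ring) hv hvr h0 hP
    rw [hP₁, hP₂, hQ₁, hQ₂, inv_inv, inv_inv, Real.inv_rpow hs.le, Real.inv_rpow hs'.le,
      ← Real.rpow_neg hs.le, ← Real.rpow_neg hs'.le, neg_sub] at key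
    change 0 ≤ s ^ (1 - r) * P₁ + s' ^ (1 - r) * P₂ - lam * (s * Q₁ + s' * Q₂)
    linarith
  have hmin : IsLocalMin F 0 := by
    have : Ioo (-(x - c)) (d - x) ∈ nhds (0 : ℝ) := Ioo_mem_nhds (by linarith) l2
    filter_upwards [this] with t ht
    rw [hF0]
    exact hFnonneg t ht.1 ht.2
  have d1 : HasDerivAt (fun t : ℝ => 1 + t / (x - c)) (1 / (x - c)) 0 :=
    ((hasDerivAt_id 0).div_const _).const_add 1
  have d2 : HasDerivAt (fun t : ℝ => 1 - t / (d - x)) (-(1 / (d - x))) 0 :=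
    ((hasDerivAt_id 0).div_const _).const_sub 1
  have hd := (((d1.rpow_const (p := 1 - r) (Or.inl (by simp))).mul_const P₁).add
    ((d2.rpow_const (p := 1 - r) (Or.inl (by simp))).mul_const P₂)).sub
      (((d1.mul_const Q₁).add (d2.mul_const Q₂)).const_mul lam)
  have hz := hmin.hasDerivAt_eq_zero hd
  simp only [zero_div, add_zero, sub_zero, Real.one_rpow, mul_one] at hz
  field_simp at hz
  linarith

/-- First integral of the Euler–Lagrange equation of an extremal of a Poincaré inequality. -/
theorem poincare_extremal_first_integral {r lam c d : ℝ} (hr : 1 < r) (hcd : c < d)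
    {v : ℝ → ℝ} (hv : IntervalIntegrable v volume c d)
    (hvr : IntervalIntegrable (fun x => |v x| ^ r) volume c d) (h0 : ∫ t in c..d, v t = 0)
    (hP : ∀ w : ℝ → ℝ, IntervalIntegrable w volume c d →
      IntervalIntegrable (fun x => |w x| ^ r) volume c d → ∫ t in c..d, w t = 0 →
      lam * (∫ x in c..d, |∫ t in c..x, w t| ^ r) ≤ ∫ x in c..d, |w x| ^ r)
    (heq : lam * (∫ x in c..d, |∫ t in c..x, v t| ^ r) = ∫ x in c..d, |v x| ^ r) :
    ∃ K, K * (d - c) = r * (∫ x in c..d, |v x| ^ r) ∧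
      ∀ᵐ x ∂(volume.restrict (Ioo c d)), (r - 1) * |v x| ^ r + lam * |∫ t in c..x, v t| ^ r = K := by
  have hVc : IntervalIntegrable (fun x => |∫ t in c..x, v t| ^ r) volume c d := by
    refine ContinuousOn.intervalIntegrable ?_
    rw [uIcc_of_le hcd.le]
    exact (continuousOn_primitive_Icc hcd.le hv).abs.rpow_const fun _ _ => Or.inr (by linarith)
  let g : ℝ → ℝ := fun x => (r - 1) * |v x| ^ r + lam * |∫ t in c..x, v t| ^ r
  have hg : IntervalIntegrable g volume c d := (hvr.const_mul _).add (hVc.const_mul _)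
  have hgint : ∀ {x y}, x ∈ Icc c d → y ∈ Icc c d → ∫ t in x..y, g t =
      (r - 1) * (∫ t in x..y, |v t| ^ r) + lam * ∫ t in x..y, |∫ t in c..t, v t| ^ r := by
    intro x y hx hy
    rw [← uIcc_of_le hcd.le] at hx hy
    have hs := uIcc_subset_uIcc hx hy
    rw [intervalIntegral.integral_add ((hvr.mono_set hs).const_mul _)
      ((hVc.mono_set hs).const_mul _), intervalIntegral.integral_const_mul,
      intervalIntegral.integral_const_mul]
  have hl := left_mem_Icc.2 hcd.le
  have hr' := right_mem_Icc.2 hcd.le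
  have hdc : 0 < d - c := sub_pos.2 hcd
  let K := (∫ t in c..d, g t) / (d - c)
  -- Stationarity says that `g` has the same mean on `(c, x)` and on `(x, d)`. Its primitive is
  -- therefore linear, and Lebesgue differentiation will make `g` constant almost everywhere.
  have hΦ : ∀ x ∈ Ioo c d, ∫ t in c..x, g t = K * (x - c) := by
    intro x hx
    have hxI := Ioo_subset_Icc_self hx
    have hs1 : uIcc c x ⊆ uIcc c d := uIcc_subset_uIcc left_mem_uIcc (by rwa [uIcc_of_le hcd.le])
    have hs2 : uIcc x d ⊆ uIcc c d := uIcc_subset_uIcc (by rwa [uIcc_of_le hcd.le]) right_mem_uIcc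
    have e1 := intervalIntegral.integral_add_adjacent_intervals (hvr.mono_set hs1)
      (hvr.mono_set hs2)
    have e2 := intervalIntegral.integral_add_adjacent_intervals (hVc.mono_set hs1)
      (hVc.mono_set hs2)
    have h := poincare_extremal_stationary hr hx hv hvr h0 hP rfl rfl rfl rfl
      (by rw [e1, e2, heq])
    rw [← hgint hl hxI, ← hgint hxI hr'] at h
    have e3 := intervalIntegral.integral_add_adjacent_intervals (hg.mono_set hs1)
      (hg.mono_set hs2)
    simp only [K]
    rw [div_mul_eq_mul_div, eq_div_iff hdc.ne', ← e3]
    linarith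
  refine ⟨K, ?_, ?_⟩
  · rw [div_mul_cancel₀ _ hdc.ne', hgint hl hr', heq]
    ring
  · rw [ae_restrict_iff' measurableSet_Ioo]
    filter_upwards [hg.ae_hasDerivAt_integral] with x hx hxI
    rw [uIcc_of_le hcd.le] at hx
    have hd1 := hx (Ioo_subset_Icc_self hxI) c hl
    have hd2 : HasDerivAt (fun x => ∫ t in c..x, g t) K x := by
      have : HasDerivAt (fun x => K * (x - c)) K x := by
        simpa using ((hasDerivAt_id x).sub_const c).const_mul K
      refine this.congr_of_eventuallyEq ?_
      filter_upwards [isOpen_Ioo.mem_nhds hxI] with y hy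
      exact hΦ y hy
    exact hd1.unique hd2

end

/-! ### Incompatibility of the two exponents and localization of weak solutions -/

section

/-- First integrals with different exponents cannot define the same slope. -/
lemma first_integrals_incompatible {p q A A' B B' M : ℝ} (hq : 1 < q) (hqp : q < p)
    (hA : 0 < A) (hB : 0 < B) (hB' : 0 < B') (hM : 0 < M)
    (h : ∀ s ∈ Icc 0 M, (A - A' * s ^ p) ^ q = (B - B' * s ^ q) ^ p) : False := by
  have hp0 : 0 < p := by linarith
  have hq0 : 0 < q := by linarith
  have hAB : A ^ q = B ^ p := by
    simpa [Real.zero_rpow hp0.ne', Real.zero_rpow hq0.ne'] using h 0 ⟨le_rfl, hM.le⟩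
  have lim : ∀ {e C D : ℝ}, 0 < e → 0 < D → ∀ᶠ s in nhdsWithin (0 : ℝ) (Ioi 0), C * s ^ e < D := by
    intro e C D he hD
    have hc : ContinuousAt (fun s : ℝ => C * s ^ e) 0 :=
      continuousAt_const.mul (Real.continuousAt_rpow_const 0 e (Or.inr he.le))
    have := hc.eventually_lt (continuousAt_const (y := D)) (by simpa [Real.zero_rpow he.ne'] using hD)
    exact this.filter_mono nhdsWithin_le_nhds
  -- Small `s` keeps the Bernoulli base positive and the other base between `0` and `1`, and, as `p
  -- > q`, makes `q (A' / A) s^p` smaller than `(B' / B) s^q`.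
  obtain ⟨s, h1, h2, h3, h4, hs⟩ := ((lim (C := A' / A) hp0 one_pos).and
    ((lim (C := B' / B) hq0 one_pos).and ((lim (C := q * (A' / A)) (sub_pos.2 hqp)
      (div_pos hB' hB)).and ((lim (C := 1) one_pos hM).and self_mem_nhdsWithin)))).exists
  have hs0 : 0 < s := hs
  rw [Real.rpow_one, one_mul] at h4
  have e1 : A - A' * s ^ p = A * (1 - A' / A * s ^ p) := by field_simp
  have e2 : B - B' * s ^ q = B * (1 - B' / B * s ^ q) := by field_simp
  have key := h s ⟨hs0.le, h4.le⟩
  rw [e1, e2, Real.mul_rpow hA.le (by linarith), Real.mul_rpow hB.le (by linarith), hAB] at key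
  have key' := mul_left_cancel₀ (Real.rpow_pos_of_pos hB p).ne' key
  -- Bernoulli bounds one side below by `1 - q (A' / A) s^p`; since `p ≥ 1`, the other is at most `1
  -- - (B' / B) s^q`, which is smaller.
  have b1 : 1 + q * -(A' / A * s ^ p) ≤ (1 + -(A' / A * s ^ p)) ^ q :=
    one_add_mul_self_le_rpow_one_add (by linarith) hq.le
  have hβ : 0 < B' / B * s ^ q := mul_pos (div_pos hB' hB) (Real.rpow_pos_of_pos hs0 q)
  have b2 : (1 - B' / B * s ^ q) ^ p ≤ 1 - B' / B * s ^ q := by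
    have := Real.rpow_le_rpow_of_exponent_ge (x := 1 - B' / B * s ^ q) (by linarith) (by linarith)
      (hq.le.trans hqp.le)
    rwa [Real.rpow_one] at this
  rw [← sub_eq_add_neg, key'] at b1
  have e3 : s ^ p = s ^ (p - q) * s ^ q := by
    rw [← Real.rpow_add hs0]; congr 1; ring
  have b3 := mul_lt_mul_of_pos_right h3 (Real.rpow_pos_of_pos hs0 q)
  rw [mul_assoc (q * (A' / A)), ← e3] at b3
  linarith

/-- Zero energy would force `v = 0` almost everywhere, hence a zero primitive. The positivity is
what gives `K, L, β > 0` for a common extremal. -/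
lemma integral_abs_rpow_pos_of_primitive_ne_zero {r c d : ℝ} (hr : 1 < r)
    {v : ℝ → ℝ} (hvr : IntervalIntegrable (fun x => |v x| ^ r) volume c d)
    {x₀ : ℝ} (hx₀ : x₀ ∈ Ioo c d) (hne : ∫ t in c..x₀, v t ≠ 0) :
    0 < ∫ x in c..d, |v x| ^ r := by
  have hcd : c ≤ d := (hx₀.1.trans hx₀.2).le
  refine (intervalIntegral.integral_nonneg hcd fun x _ => by positivity).lt_of_ne' fun h => hne ?_
  rw [intervalIntegral.integral_eq_zero_iff_of_le_of_nonneg_ae hcd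
    (Filter.Eventually.of_forall fun x => by positivity) hvr] at h
  have h' : v =ᵐ[volume.restrict (Ioc c d)] 0 := by
    filter_upwards [h] with x hx
    simpa using ((Real.rpow_eq_zero (abs_nonneg _) (by linarith)).1 hx)
  have h'' : v =ᵐ[volume.restrict (uIoc c x₀)] fun _ => 0 := by
    rw [uIoc_of_le hx₀.1.le]
    exact ae_restrict_of_ae_restrict_of_subset (Ioc_subset_Ioc_right hx₀.2.le) h'
  rw [intervalIntegral.integral_congr_ae_restrict h'']
  simp

/-- Poincaré inequalities with different exponents have no common extremal. -/
theorem poincare_no_common_extremal {p q α β c d : ℝ} (hq : 1 < q) (hqp : q < p)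
    {v : ℝ → ℝ} (hv : IntervalIntegrable v volume c d)
    (hvp : IntervalIntegrable (fun x => |v x| ^ p) volume c d)
    (hvq : IntervalIntegrable (fun x => |v x| ^ q) volume c d) (h0 : ∫ t in c..d, v t = 0)
    {x₀ : ℝ} (hx₀ : x₀ ∈ Ioo c d) (hne : ∫ t in c..x₀, v t ≠ 0)
    (hP : ∀ w : ℝ → ℝ, IntervalIntegrable w volume c d →
      IntervalIntegrable (fun x => |w x| ^ p) volume c d → ∫ t in c..d, w t = 0 →
      α * (∫ x in c..d, |∫ t in c..x, w t| ^ p) ≤ ∫ x in c..d, |w x| ^ p)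
    (hPeq : α * (∫ x in c..d, |∫ t in c..x, v t| ^ p) = ∫ x in c..d, |v x| ^ p)
    (hQ : ∀ w : ℝ → ℝ, IntervalIntegrable w volume c d →
      IntervalIntegrable (fun x => |w x| ^ q) volume c d → ∫ t in c..d, w t = 0 →
      β * (∫ x in c..d, |∫ t in c..x, w t| ^ q) ≤ ∫ x in c..d, |w x| ^ q)
    (hQeq : β * (∫ x in c..d, |∫ t in c..x, v t| ^ q) = ∫ x in c..d, |v x| ^ q) : False := by
  have hp : 1 < p := hq.trans hqp
  have hcd : c < d := hx₀.1.trans hx₀.2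
  have hdc : 0 < d - c := sub_pos.2 hcd
  have Ip := integral_abs_rpow_pos_of_primitive_ne_zero hp hvp hx₀ hne
  have Iq := integral_abs_rpow_pos_of_primitive_ne_zero hq hvq hx₀ hne
  obtain ⟨K, hK, hKae⟩ := poincare_extremal_first_integral hp hcd hv hvp h0 hP hPeq
  obtain ⟨L, hL, hLae⟩ := poincare_extremal_first_integral hq hcd hv hvq h0 hQ hQeq
  have hKpos : 0 < K := pos_of_mul_pos_left (hK ▸ mul_pos (by linarith) Ip) hdc.le
  have hLpos : 0 < L := pos_of_mul_pos_left (hL ▸ mul_pos (by linarith) Iq) hdc.le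
  have hβ : 0 < β := pos_of_mul_pos_left (hQeq ▸ Iq)
    (intervalIntegral.integral_nonneg hcd.le fun x _ => by positivity)
  have hVc := continuousOn_primitive_Icc hcd.le hv
  have hcont : ∀ {A A' s e : ℝ}, 1 < s → 1 < e →
      ContinuousOn (fun x => (A - A' * |∫ t in c..x, v t| ^ s) ^ e) (Icc c d) := fun hs he =>
    (continuousOn_const.sub (continuousOn_const.mul
      (hVc.abs.rpow_const fun _ _ => Or.inr (by linarith)))).rpow_const
        fun _ _ => Or.inr (by linarith)
  -- Both sides equal `|v x|^{pq}` almost everywhere; by continuity they agree on all of `[c, d]`.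
  have hae : (fun x => (K / (p - 1) - α / (p - 1) * |∫ t in c..x, v t| ^ p) ^ q)
      =ᵐ[volume.restrict (Icc c d)]
      fun x => (L / (q - 1) - β / (q - 1) * |∫ t in c..x, v t| ^ q) ^ p := by
    rw [← restrict_Ioo_eq_restrict_Icc]
    filter_upwards [hKae, hLae] with x h1 h2
    have hp1 : p - 1 ≠ 0 := by linarith
    have hq1 : q - 1 ≠ 0 := by linarith
    have e1 : K / (p - 1) - α / (p - 1) * |∫ t in c..x, v t| ^ p = |v x| ^ p := by
      rw [← h1]; field_simp; ring
    have e2 : L / (q - 1) - β / (q - 1) * |∫ t in c..x, v t| ^ q = |v x| ^ q := by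
      rw [← h2]; field_simp; ring
    rw [e1, e2, ← Real.rpow_mul (abs_nonneg _), ← Real.rpow_mul (abs_nonneg _), mul_comm]
  have hall := Measure.eqOn_Icc_of_ae_eq volume hcd.ne hae (hcont hp hq) (hcont hq hp)
  refine first_integrals_incompatible (A := K / (p - 1)) (A' := α / (p - 1))
    (B := L / (q - 1)) (B' := β / (q - 1)) hq hqp (div_pos hKpos (by linarith))
    (div_pos hLpos (by linarith)) (div_pos hβ (by linarith)) (abs_pos.2 hne) fun s hs => ?_
  -- The primitive vanishes at `c`, so its absolute value takes every value in `[0, M]` with `M` its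
  -- value at `x₀`.
  have hiv := intermediate_value_Icc hx₀.1.le
    (hVc.abs.mono (Icc_subset_Icc_right hx₀.2.le))
  rw [intervalIntegral.integral_same, abs_zero] at hiv
  obtain ⟨x, hx, rfl⟩ := hiv hs
  exact hall ⟨hx.1, hx.2.trans hx₀.2.le⟩

lemma abs_rpow_sub_two_mul_self_mul_self {s : ℝ} (hs : 1 < s) (x : ℝ) :
    |x| ^ (s - 2) * x * x = |x| ^ s := by
  rcases eq_or_ne x 0 with rfl | hx
  · simp [Real.zero_rpow (by linarith : s ≠ 0)]
  · rw [mul_assoc, ← abs_mul_abs_self, ← pow_two, ← Real.rpow_natCast,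
      ← Real.rpow_add (abs_pos.2 hx)]
    congr 1
    push_cast
    ring

lemma integral_abs_rpow_mul_indicator {s a b c d : ℝ} (hs : 1 < s) (hac : a ≤ c) (hcd : c ≤ d)
    (hdb : d ≤ b) {f φ : ℝ → ℝ}
    (h : φ =ᵐ[volume.restrict (Ioo a b)] (Ioo c d).indicator f) :
    ∫ x in Ioo a b, |f x| ^ (s - 2) * f x * φ x = ∫ x in c..d, |f x| ^ s := by
  have : ∫ x in Ioo a b, |f x| ^ (s - 2) * f x * φ x =
      ∫ x in Ioo a b, (Ioo c d).indicator (fun x => |f x| ^ s) x := by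
    refine integral_congr_ae ?_
    filter_upwards [h] with x hx
    rw [hx]
    by_cases hx' : x ∈ Ioo c d
    · simp only [indicator_of_mem hx']
      exact abs_rpow_sub_two_mul_self_mul_self hs _
    · simp [hx']
  rw [this, setIntegral_indicator measurableSet_Ioo,
    inter_eq_self_of_subset_right (Ioo_subset_Ioo hac hdb), intervalIntegral.integral_of_le hcd,
    integral_Ioc_eq_integral_Ioo]

/-- A weak solution below the second eigenvalues vanishes between two of its zeros that are at most
half the length of the interval apart. -/
theorem IsWeakSolution.eq_zero_between_zeros {p q a b α β : ℝ} [Fact (1 < p)] [Fact (1 < q)]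
    (hqp : q < p) (hα : α ≤ eigenvalue 2 p a b) (hβ : β ≤ eigenvalue 2 q a b)
    {u : W0 p a b} (hu : IsWeakSolution p q a b α β u) {c d x₀ : ℝ} (hac : a ≤ c) (hdb : d ≤ b)
    (hL : d - c ≤ (b - a) / 2) (hc : ∫ t in a..c, W0.grad u t = 0)
    (hd : ∫ t in a..d, W0.grad u t = 0) (hx₀ : x₀ ∈ Ioo c d) :
    ∫ t in a..x₀, W0.grad u t = 0 := by
  have hp1 : 1 < p := Fact.out
  have hq1 : 1 < q := Fact.out
  have hcd : c < d := hx₀.1.trans hx₀.2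
  have hab : a < b := hac.trans_lt (hcd.trans_le hdb)
  by_contra hne
  have haI : a ∈ Icc a b := left_mem_Icc.2 hab.le
  have hcI : c ∈ Icc a b := ⟨hac, hcd.le.trans hdb⟩
  have hV : ∀ x ∈ Icc c d, ∫ t in c..x, W0.grad u t = ∫ t in a..x, W0.grad u t := by
    intro x hx
    rw [← intervalIntegral.integral_add_adjacent_intervals
      (intervalIntegrable_of_integrable_Ioo (W0.grad u).integrable haI hcI)
      (intervalIntegrable_of_integrable_Ioo (W0.grad u).integrable hcI
        ⟨hac.trans hx.1, hx.2.trans hdb⟩), hc, zero_add]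
  have hm : MemLp (W0.grad u) (ENNReal.ofReal p) (volume.restrict (Ioo c d)) :=
    (Lp.memLp (W0.grad u)).mono_measure (Measure.restrict_mono (Ioo_subset_Ioo hac hdb) le_rfl)
  obtain ⟨hv, hvp⟩ := (memLp_Ioo_iff hp1 hcd.le).1 hm
  obtain ⟨-, hvq⟩ := (memLp_Ioo_iff hq1 hcd.le).1
    (hm.mono_exponent (ENNReal.ofReal_le_ofReal hqp.le))
  have h0 : ∫ t in c..d, W0.grad u t = 0 := (hV d (right_mem_Icc.2 hcd.le)).trans hd
  -- The cutoff of `u` to `(c, d)` is an admissible test function because `c` and `d` are zeros of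
  -- `u`.
  obtain ⟨φ, hφ1, hφ2⟩ := W0.exists_extension (r := p) hac hcd hdb hv hvp h0
  have huv := (W0.integral_grad_and_val_ae_eq hab u).2
  have hval : ∀ᵐ x ∂(volume.restrict (Ioo a b)), x ∈ Ioo c d →
      ∫ t in c..x, W0.grad u t = W0.val u x := by
    filter_upwards [huv] with x hx hxI
    rw [hx, hV x (Ioo_subset_Icc_self hxI)]
  have hφ2' : (W0.val φ : ℝ → ℝ) =ᵐ[volume.restrict (Ioo a b)]
      (Ioo c d).indicator (W0.val u) := by
    filter_upwards [hφ2, hval] with x hx1 hx2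
    rw [hx1]
    by_cases hx : x ∈ Ioo c d
    · rw [indicator_of_mem hx, indicator_of_mem hx, hx2 hx]
    · rw [indicator_of_notMem hx, indicator_of_notMem hx]
  have hJ : ∀ s : ℝ, ∫ x in c..d, |W0.val u x| ^ s =
      ∫ x in c..d, |∫ t in c..x, W0.grad u t| ^ s := by
    intro s
    rw [intervalIntegral.integral_of_le hcd.le, intervalIntegral.integral_of_le hcd.le,
      integral_Ioc_eq_integral_Ioo, integral_Ioc_eq_integral_Ioo]
    refine integral_congr_ae ?_
    filter_upwards [ae_restrict_of_ae_restrict_of_subset (Ioo_subset_Ioo hac hdb) hval,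
      ae_restrict_mem measurableSet_Ioo] with x hx hxI
    rw [hx hxI]
  have heq := hu φ
  rw [integral_abs_rpow_mul_indicator hp1 hac hcd.le hdb hφ1,
    integral_abs_rpow_mul_indicator hq1 hac hcd.le hdb hφ1,
    integral_abs_rpow_mul_indicator hp1 hac hcd.le hdb hφ2',
    integral_abs_rpow_mul_indicator hq1 hac hcd.le hdb hφ2', hJ, hJ] at heq
  have hnn : ∀ (s : ℝ) (w : ℝ → ℝ), 0 ≤ ∫ x in c..d, |∫ t in c..x, w t| ^ s := fun s w =>
    intervalIntegral.integral_nonneg hcd.le fun x _ => by positivity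
  have hP : ∀ w : ℝ → ℝ, IntervalIntegrable w volume c d →
      IntervalIntegrable (fun x => |w x| ^ p) volume c d → ∫ t in c..d, w t = 0 →
      α * (∫ x in c..d, |∫ t in c..x, w t| ^ p) ≤ ∫ x in c..d, |w x| ^ p := fun w h1 h2 h3 =>
    (mul_le_mul_of_nonneg_right hα (hnn p w)).trans (eigenvalue_two_mul_integral_le hcd hL h1 h2 h3)
  have hQ : ∀ w : ℝ → ℝ, IntervalIntegrable w volume c d →
      IntervalIntegrable (fun x => |w x| ^ q) volume c d → ∫ t in c..d, w t = 0 →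
      β * (∫ x in c..d, |∫ t in c..x, w t| ^ q) ≤ ∫ x in c..d, |w x| ^ q := fun w h1 h2 h3 =>
    (mul_le_mul_of_nonneg_right hβ (hnn q w)).trans (eigenvalue_two_mul_integral_le hcd hL h1 h2 h3)
  have hp' := hP _ hv hvp h0
  have hq' := hQ _ hv hvq h0
  -- The tested equation equates the sums of the two sides of `hp'` and `hq'`, which forces equality
  -- in each.
  exact poincare_no_common_extremal hq1 hqp hv hvp hvq h0 hx₀
    (by rwa [hV x₀ (Ioo_subset_Icc_self hx₀)]) hP (by linarith) hQ (by linarith)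

end

end PQLaplace

end

theorem theorem1p2 (p q : ℝ) [Fact (1 < p)] [Fact (1 < q)] (hqp : q < p)
    (a b : ℝ) (hab : a < b) (α β : ℝ)
    (hα : α ≤ PQLaplace.eigenvalue 2 p a b)
    (hβ : β ≤ PQLaplace.eigenvalue 2 q a b) :
    ¬ ∃ u : PQLaplace.W0 p a b, PQLaplace.IsNodalSolution p q a b α β u := by
  rintro ⟨u, hu, hpos, hneg⟩
  obtain ⟨hend, hval⟩ := PQLaplace.W0.integral_grad_and_val_ae_eq hab u
  have hcont := PQLaplace.continuousOn_primitive_Ioo hab.le (PQLaplace.W0.grad u).integrable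
  obtain ⟨x₁, hx₁, h1⟩ : ∃ x ∈ Ioo a b, 0 < ∫ t in a..x, PQLaplace.W0.grad u t := by
    by_contra! h
    refine hpos ?_
    filter_upwards [hval, ae_restrict_mem measurableSet_Ioo] with x hx hxI
    rw [hx]
    exact max_eq_right (h x hxI)
  obtain ⟨x₂, hx₂, h2⟩ : ∃ x ∈ Ioo a b, ∫ t in a..x, PQLaplace.W0.grad u t < 0 := by
    by_contra! h
    refine hneg ?_
    filter_upwards [hval, ae_restrict_mem measurableSet_Ioo] with x hx hxI
    rw [hx]
    exact max_eq_right (neg_nonpos.2 (h x hxI))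
  obtain ⟨y, z, e, hay, hye, hez, hzb, hy, hz, he⟩ : ∃ y z e, a < y ∧ y < e ∧ e < z ∧ z < b ∧
      ∫ t in a..y, PQLaplace.W0.grad u t ≠ 0 ∧ ∫ t in a..z, PQLaplace.W0.grad u t ≠ 0 ∧
      ∫ t in a..e, PQLaplace.W0.grad u t = 0 := by
    have hsub : uIcc x₁ x₂ ⊆ Icc a b :=
      uIcc_subset_Icc (Ioo_subset_Icc_self hx₁) (Ioo_subset_Icc_self hx₂)
    have hiv := intermediate_value_uIcc (hcont.mono hsub)
    obtain ⟨e, heI, he⟩ := hiv (mem_uIcc.2 (Or.inr ⟨h2.le, h1.le⟩))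
    simp only at he
    have ne1 : e ≠ x₁ := by rintro rfl; exact h1.ne' he
    have ne2 : e ≠ x₂ := by rintro rfl; exact h2.ne he
    rcases mem_uIcc.1 heI with h | h
    · exact ⟨x₁, x₂, e, hx₁.1, lt_of_le_of_ne h.1 ne1.symm, lt_of_le_of_ne h.2 ne2, hx₂.2,
        h1.ne', h2.ne, he⟩
    · exact ⟨x₂, x₁, e, hx₂.1, lt_of_le_of_ne h.1 ne2.symm, lt_of_le_of_ne h.2 ne1, hx₁.2,
        h2.ne, h1.ne', he⟩
  -- At least one of `(a, e)` and `(e, b)` has length at most half; `u` would vanish on it,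
  -- contradicting its value at `y` or `z`.
  rcases le_total (e - a) ((b - a) / 2) with h | h
  · exact hy (hu.eq_zero_between_zeros hqp hα hβ le_rfl (by linarith) h (by simp) he ⟨hay, hye⟩)
  · exact hz (hu.eq_zero_between_zeros hqp hα hβ (by linarith) le_rfl (by linarith) he hend
      ⟨hez, hzb⟩)
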